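/- **Setting.** Let $y=(y_i)_{i\in V}$ be finitely many variables, $y_i$ ranging over a finite non-empty set $\mathcal X_i$, and let $\mathcal C$ be a finite set of subsets of $V$ (cliques). Let $S(y)$ be the 0-1 vector that concatenates the indicators $\mathbf 1[y_i=x]$ ($i\in V$, $x\in\mathcal X_i$) and $\mathbf 1[y_c=z]$ ($c\in\mathcal C$, $z\in\prod_{i\in c}\mathcal X_i$). The marginal polytope is $\mathcal M=\{\mathbb E_P[S(y)] : P \text{ a probability distribution on } \prod_i\mathcal X_i\}$. With $d_i=\#\{c\in\mathcal C: i\in c\}$, the Bethe entropy is $$H_{\mathcal B}(\mu)=\sum_{c\in\mathcal C}H(\mu_c)-\sum_{i\in V}(d_i-1)H(\mu_i),\qquad H(p)=-\sum_x p(x)\ln p(x).$$ For a parameter vector $\theta$ and an energy function $L$, the augmented objective is $F(\mu)=-H_{\mathcal B}(\mu)-\langle\theta,\mu\rangle+L(\mu)$ on $\mathcal M$. Let $\mathrm{MO}$ be a marginal oracle, that is, one of the following two maps: (a) for every $\theta$, $\mathrm{MO}(\theta)$ is a minimizer of $-H_{\mathcal B}(\mu)-\langle\theta,\mu\rangle$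 over $\mu\in\mathcal M$; or (b) $\mathcal C$ is the edge set of a graph without cycles (for instance a tree) and $\mathrm{MO}(\theta)=\mathbb E_{P_\theta}[S(y)]$ is the vector of exact marginals of $P_\theta(y)\propto\exp\langle\theta,S(y)\rangle$. Algorithm Bethe-MD with learning rates $(\eta_t)_{t\ge1}$ sets $\mu_0=\mathrm{MO}(\theta)$ and, for $t\ge 1$, $$g_t=\nabla H_{\mathcal B}(\mu_{t-1})+\eta_t\nabla L(\mu_{t-1}),\qquad \mu_t=\mathrm{MO}\Big(\tfrac{1}{1+\eta_t}(\eta_t\theta-g_t)\Big).$$ **Proposition (Bethe-MD convergence).** Suppose that $L$ is convex on $\mathcal M$, differentiable at every point of $\mathcal M$ with all coordinates positive, and Lipschitz on $\mathcal M$. Let $\lambda>0$ be such that $-H_{\mathcal B}$ is $\lambda$-strongly convex with respect to the 2-norm on the relative interior of $\mathcal M$, and let $\eta_t=\frac1{\lambda t}$ for $t\ge1$. Then $F$ attains its minimum over $\mathcal M$ at some $\mu^*\in\mathcal M$, the primal averages $\bar\mu_t=\frac1t\sum_{s=1}^t\mu_s$ lie in $\mathcal M$ and converge to $\mu^*$,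 and there is a constant $C$ such that $$F(\bar\mu_t)-F(\mu^*)\le C\,\frac{\ln t}{t}\qquad\text{for all } t\ge 2 .$$ -/

import Mathlib

open scoped Gradient RealInnerProductSpace

noncomputable section

namespace BetheMD

variable {V : Type*} [Fintype V] [DecidableEq V]
  {X : V → Type*} [∀ i, Fintype (X i)] [∀ i, DecidableEq (X i)]

/-- Coordinates of the concatenated vector of node and clique marginals: a node with one of its
states, or a clique with one of its joint states. -/
abbrev Index (X : V → Type*) (𝒞 : Finset (Finset V)) : Type _ :=
  (Σ i : V, X i) ⊕ (Σ c : {c : Finset V // c ∈ 𝒞}, ((i : {i : V // i ∈ c.1}) → X i.1))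

/-- The space of (concatenated) marginal vectors and of parameters, with the 2-norm. -/
abbrev MargVec (X : V → Type*) (𝒞 : Finset (Finset V)) : Type _ :=
  EuclideanSpace ℝ (Index X 𝒞)

/-- The 0-1 sufficient statistics `S(y)`: indicators of the states of all nodes and all cliques. -/
def suffStat (𝒞 : Finset (Finset V)) (y : (i : V) → X i) : MargVec X 𝒞 :=
  WithLp.toLp 2 fun k =>
    match k with
    | Sum.inl ⟨i, x⟩ => if y i = x then 1 else 0
    | Sum.inr ⟨c, z⟩ => if (fun i : {i : V // i ∈ c.1} => y i.1) = z then 1 else 0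

/-- The expected sufficient statistics `μ(P) = 𝔼_P[S(y)]`. -/
def meanStat (𝒞 : Finset (Finset V)) (P : ((i : V) → X i) → ℝ) : MargVec X 𝒞 :=
  ∑ y, P y • suffStat 𝒞 y

/-- The marginal polytope: all vectors `μ(P)`, for `P` a probability distribution on joint
configurations. -/
def marginalPolytope (X : V → Type*) [∀ i, Fintype (X i)] [∀ i, DecidableEq (X i)]
    (𝒞 : Finset (Finset V)) : Set (MargVec X 𝒞) :=
  meanStat 𝒞 '' stdSimplex ℝ ((i : V) → X i)

/-- The Markov random field `P_θ(y) = exp ⟨θ, S(y)⟩ / Z`. -/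
def gibbs (𝒞 : Finset (Finset V)) (θ : MargVec X 𝒞) (y : (i : V) → X i) : ℝ :=
  Real.exp ⟪θ, suffStat 𝒞 y⟫ / ∑ y', Real.exp ⟪θ, suffStat 𝒞 y'⟫

/-- The exact vector of node and clique marginals of `P_θ`. -/
def gibbsMarginals (𝒞 : Finset (Finset V)) (θ : MargVec X 𝒞) : MargVec X 𝒞 :=
  meanStat 𝒞 (gibbs 𝒞 θ)

/-- Entropy of the marginal of node `i`. -/
def nodeEntropy {𝒞 : Finset (Finset V)} (μ : MargVec X 𝒞) (i : V) : ℝ :=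
  ∑ x : X i, Real.negMulLog (μ (Sum.inl ⟨i, x⟩))

/-- Entropy of the marginal of clique `c`. -/
def cliqueEntropy {𝒞 : Finset (Finset V)} (μ : MargVec X 𝒞) (c : {c : Finset V // c ∈ 𝒞}) : ℝ :=
  ∑ z : (i : {i : V // i ∈ c.1}) → X i.1, Real.negMulLog (μ (Sum.inr ⟨c, z⟩))

/-- The Bethe entropy `∑_c H(μ_c) - ∑_i (d_i - 1) H(μ_i)`, where `d_i` is the number of cliques
that contain node `i`. If all cliques are pairs, this equals `∑_i H(μ_i) - ∑_{ij} I(μ_{ij})` on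
the marginal polytope. -/
def betheEntropy (𝒞 : Finset (Finset V)) (μ : MargVec X 𝒞) : ℝ :=
  ∑ c, cliqueEntropy μ c -
    ∑ i, (((𝒞.filter fun c => i ∈ c).card : ℝ) - 1) * nodeEntropy μ i

/-- The base objective `-H_B(μ) - ⟨θ, μ⟩` of marginal inference. -/
def baseObjective (𝒞 : Finset (Finset V)) (θ μ : MargVec X 𝒞) : ℝ :=
  -betheEntropy 𝒞 μ - ⟪θ, μ⟫

/-- The augmented objective `-H_B(μ) - ⟨θ, μ⟩ + L(μ)`. -/
def augObjective (𝒞 : Finset (Finset V)) (θ : MargVec X 𝒞) (L : MargVec X 𝒞 → ℝ)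
    (μ : MargVec X 𝒞) : ℝ :=
  -betheEntropy 𝒞 μ - ⟪θ, μ⟫ + L μ

/-- The cliques are exactly the edges of a graph without cycles (for instance, of a tree). -/
def IsTreeStructured (𝒞 : Finset (Finset V)) : Prop :=
  ∃ G : SimpleGraph V, G.IsAcyclic ∧ ∀ c : Finset V, c ∈ 𝒞 ↔ ∃ u v, G.Adj u v ∧ c = {u, v}

/-- A variational marginal oracle solves `argmin_{μ ∈ M} -H_B(μ) - ⟨θ, μ⟩`. -/
def IsBetheOracle (𝒞 : Finset (Finset V)) (O : MargVec X 𝒞 → MargVec X 𝒞) : Prop :=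
  ∀ θ, O θ ∈ marginalPolytope X 𝒞 ∧ IsMinOn (baseObjective 𝒞 θ) (marginalPolytope X 𝒞) (O θ)

/-- An exact marginal oracle, for tree-structured models, returns the marginals of `P_θ`. -/
def IsExactTreeOracle (𝒞 : Finset (Finset V)) (O : MargVec X 𝒞 → MargVec X 𝒞) : Prop :=
  IsTreeStructured 𝒞 ∧ ∀ θ, O θ = gibbsMarginals 𝒞 θ

/-- The iterates `μ_0, μ_1, …` of Bethe-MD with marginal oracle `O`, parameters `θ`, energy `L` and
learning rates `η_1, η_2, …`. -/
def iterates (𝒞 : Finset (Finset V)) (O : MargVec X 𝒞 → MargVec X 𝒞) (θ : MargVec X 𝒞)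
    (L : MargVec X 𝒞 → ℝ) (η : ℕ → ℝ) : ℕ → MargVec X 𝒞
  | 0 => O θ
  | t + 1 =>
    let μ := iterates 𝒞 O θ L η t
    let g := ∇ (betheEntropy 𝒞) μ + η (t + 1) • ∇ L μ
    O ((1 / (1 + η (t + 1))) • (η (t + 1) • θ - g))

/-- The average `(μ_1 + ⋯ + μ_t) / t` of the first `t` primal iterates. -/
def primalAverage {𝒞 : Finset (Finset V)} (μ : ℕ → MargVec X 𝒞) (t : ℕ) : MargVec X 𝒞 :=
  (1 / (t : ℝ)) • ∑ s ∈ Finset.Icc 1 t, μ s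

end BetheMD

end

/-! Write `D` for the Bregman divergence `bregman` of `-H_B`. The argument passed to the oracle is
chosen so that `μ_t` satisfies the first-order condition for minimizing `D(·, μ_{t-1}) + η_t (-H_B -
⟨θ, ·⟩ + ⟨∇L(μ_{t-1}), ·⟩)` over the polytope: a mirror descent step in which only `L` is
linearized. Both oracles supply this condition at a positive point (`oracle_spec`). A Bethe
minimizer is positive because some feasible direction at a boundary point has infinite entropy slope
(`pos_of_isMinOn`). Exact forest marginals are critical because the Gibbs distribution is, up to a
constant, `∏_c P_c ∏_i P_i^(1-d_i)` (`exists_log_eq_sum_log_marg`).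

Let `p` be a minimizer of `F` and `d_t = D(p, μ_t)`. The usual estimate (`mirror_step`) with `η_t =
1/(λt)` gives `F(μ_t) - F(p) + (λt + 1) d_t ≤ λt d_{t-1} + c/t`. Telescoping needs the coefficient
`λ(t+1)` on the left, which is available directly only for `λ ≤ 1`. The missing part is taken from
the gap: `F(μ) - F(p) = D(μ, p) + G(μ)` with `G ≥ 0` convex (`excessGap`), and `D(μ, p) ≥ D(p, μ) -
C D(p, μ)^(3/2)` (`bregman_sub_le_rpow`). This raises the coefficient to `λt + 2`, up to the error,
and `λ ≤ 2` always holds unless the polytope is a point (`strongConvexity_le_two`). The error is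
absorbed by bootstrapping the decay of `d_t` from `t^(-1/2)` to `t^(-3/4)` to `log t / t`
(`exists_rates`).

Since `D(μ_t, p)` has been spent, the sum of the gaps is bounded only for `G`. At the average, `G`
is handled by Jensen, and `D(·, p)` by a quadratic upper bound at the positive point `p` together
with the distances that strong convexity extracts from `d_s` (`rate_of_primalAverage`). -/

noncomputable section

set_option linter.unusedSectionVars false

/-! ### Convexity on the relative interior -/

section Convexity

open Filter Topology

variable {E : Type*} [NormedAddCommGroup E]

/-- A point of a set lies in its intrinsic interior as soon as the set is a neighbourhood of the
point within its affine span. -/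
theorem mem_intrinsicInterior_iff_mem_nhdsWithin [NormedSpace ℝ E] {s : Set E} {x : E} :
    x ∈ intrinsicInterior ℝ s ↔ x ∈ affineSpan ℝ s ∧ s ∈ 𝓝[affineSpan ℝ s] x := by
  rw [mem_intrinsicInterior]
  constructor
  · rintro ⟨y, hy, rfl⟩
    exact ⟨y.2, preimage_coe_mem_nhds_subtype.1 (mem_interior_iff_mem_nhds.1 hy)⟩
  · rintro ⟨hx, h⟩
    exact ⟨⟨x, hx⟩, mem_interior_iff_mem_nhds.2 (preimage_coe_mem_nhds_subtype.2 h), rfl⟩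

/-- Contracting an intrinsically interior point towards a point of a convex set stays in the
intrinsic interior. -/
theorem Convex.combo_intrinsicInterior_mem [NormedSpace ℝ E] {s : Set E} (hs : Convex ℝ s)
    {x y : E} (hx : x ∈ intrinsicInterior ℝ s) (hy : y ∈ s) {c : ℝ} (hc : 0 < c) (hc1 : c ≤ 1) :
    y + c • (x - y) ∈ intrinsicInterior ℝ s := by
  rw [mem_intrinsicInterior_iff_mem_nhdsWithin] at hx ⊢
  have hyA : y ∈ affineSpan ℝ s := subset_affineSpan ℝ s hy
  have key : ∀ (a : ℝ) (z : E), z ∈ affineSpan ℝ s → y + a • (z - y) ∈ affineSpan ℝ s := by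
    intro a z hz
    have := AffineMap.lineMap_mem a hyA hz
    rwa [AffineMap.lineMap_apply, vsub_eq_sub, vadd_eq_add, add_comm] at this
  refine ⟨key c x hx.1, ?_⟩
  have hcont : Tendsto (fun z => y + c⁻¹ • (z - y)) (𝓝[affineSpan ℝ s] (y + c • (x - y)))
      (𝓝[affineSpan ℝ s] x) := by
    refine tendsto_nhdsWithin_iff.2 ⟨?_, ?_⟩
    · have hc' : Continuous fun z : E => y + c⁻¹ • (z - y) := by fun_prop
      have := hc'.tendsto (y + c • (x - y))
      simp only [add_sub_cancel_left, smul_smul, inv_mul_cancel₀ hc.ne', one_smul,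
        add_sub_cancel] at this
      exact this.mono_left nhdsWithin_le_nhds
    · filter_upwards [self_mem_nhdsWithin] with z hz using key _ z hz
  filter_upwards [hcont hx.2] with z hz
  have h := hs.add_smul_sub_mem hy hz ⟨hc.le, hc1⟩
  simpa [smul_smul, mul_inv_cancel₀ hc.ne'] using h

theorem Convex.subset_closure_intrinsicInterior [NormedSpace ℝ E] [FiniteDimensional ℝ E]
    {s : Set E} (hs : Convex ℝ s) : s ⊆ closure (intrinsicInterior ℝ s) := by
  intro y hy
  obtain ⟨x, hx⟩ := Set.Nonempty.intrinsicInterior hs ⟨y, hy⟩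
  have hcont : Tendsto (fun c : ℝ => y + c • (x - y)) (𝓝[>] 0) (𝓝 y) := by
    have hc' : Continuous fun c : ℝ => y + c • (x - y) := by fun_prop
    have := hc'.tendsto 0
    simp only [zero_smul, add_zero] at this
    exact this.mono_left nhdsWithin_le_nhds
  refine mem_closure_of_tendsto hcont ?_
  filter_upwards [Ioc_mem_nhdsGT (zero_lt_one' ℝ)] with c hc
  exact hs.combo_intrinsicInterior_mem hx hy hc.1 hc.2

/-- A continuous function which is strongly convex on the relative interior of a convex set is
strongly convex on the whole set. -/
theorem StrongConvexOn.of_intrinsicInterior [NormedSpace ℝ E] [FiniteDimensional ℝ E]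
    {s : Set E} (hs : Convex ℝ s) {f : E → ℝ} (hf : Continuous f) {m : ℝ}
    (h : StrongConvexOn (intrinsicInterior ℝ s) m f) : StrongConvexOn s m f := by
  refine ⟨hs, fun x hx y hy a b ha hb hab => ?_⟩
  have hcl : IsClosed {p : E × E | f (a • p.1 + b • p.2) ≤
      a • f p.1 + b • f p.2 - a * b * (m / 2 * ‖p.1 - p.2‖ ^ 2)} :=
    isClosed_le (by fun_prop) (by fun_prop)
  have hsub : (intrinsicInterior ℝ s) ×ˢ (intrinsicInterior ℝ s) ⊆ {p : E × E |
      f (a • p.1 + b • p.2) ≤ a • f p.1 + b • f p.2 - a * b * (m / 2 * ‖p.1 - p.2‖ ^ 2)} :=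
    fun p hp => h.2 hp.1 hp.2 ha hb hab
  have hmem : (x, y) ∈ closure ((intrinsicInterior ℝ s) ×ˢ (intrinsicInterior ℝ s)) := by
    rw [closure_prod_eq]
    exact ⟨hs.subset_closure_intrinsicInterior hx, hs.subset_closure_intrinsicInterior hy⟩
  exact closure_minimal hsub hcl hmem

/-! ### First-order inequalities from one-sided slopes. -/

variable [InnerProductSpace ℝ E] [CompleteSpace E]

theorem HasGradientAt.tendsto_slope_inner {f : E → ℝ} {g w : E} (h : HasGradientAt f g w) (v : E) :
    Tendsto (fun s : ℝ => s⁻¹ * (f (w + s • v) - f w)) (𝓝[>] 0) (𝓝 ⟪g, v⟫) := by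
  have h1 := h.hasFDerivAt.hasLineDerivAt v
  have h2 := h1.tendsto_slope_zero_right
  simpa using h2

/-- The bound `c` may vary with the step length because the quadratic term of strong convexity comes
with a factor `1 - s`, whose limit is needed. -/
theorem HasGradientAt.inner_le_of_forall_le {f : E → ℝ} {g w : E} (h : HasGradientAt f g w)
    {v : E} {c : ℝ → ℝ} (hc : Continuous c)
    (hle : ∀ s : ℝ, 0 < s → s < 1 → f (w + s • v) - f w ≤ s * c s) : ⟪g, v⟫ ≤ c 0 := by
  refine le_of_tendsto_of_tendsto (h.tendsto_slope_inner v)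
    ((hc.tendsto 0).mono_left nhdsWithin_le_nhds) ?_
  filter_upwards [Ioo_mem_nhdsGT (zero_lt_one' ℝ)] with s hs
  have := hle s hs.1 hs.2
  rw [inv_mul_le_iff₀ hs.1]
  exact this

theorem HasGradientAt.le_inner_of_forall_le {f : E → ℝ} {g w : E} (h : HasGradientAt f g w)
    {v : E} {c : ℝ} (hle : ∀ s : ℝ, 0 < s → s < 1 → s * c ≤ f (w + s • v) - f w) :
    c ≤ ⟪g, v⟫ := by
  refine ge_of_tendsto (h.tendsto_slope_inner v) ?_
  filter_upwards [Ioo_mem_nhdsGT (zero_lt_one' ℝ)] with s hs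
  have := hle s hs.1 hs.2
  rw [le_inv_mul_iff₀ hs.1]
  exact this

theorem StrongConvexOn.add_inner_le {f : E → ℝ} {s : Set E} {m : ℝ} (hf : StrongConvexOn s m f)
    {g w u : E} (h : HasGradientAt f g w) (hw : w ∈ s) (hu : u ∈ s) :
    f w + ⟪g, u - w⟫ + m / 2 * ‖u - w‖ ^ 2 ≤ f u := by
  have := h.inner_le_of_forall_le (v := u - w)
    (c := fun t => f u - f w - (1 - t) * (m / 2 * ‖u - w‖ ^ 2)) (by fun_prop) (by
      intro t ht0 ht1
      have := hf.2 hu hw ht0.le (sub_nonneg.2 ht1.le) (by ring)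
      have he : t • u + (1 - t) • w = w + t • (u - w) := by module
      rw [he] at this
      simp only [smul_eq_mul] at this
      linarith)
  simp only [sub_zero, one_mul] at this
  linarith

theorem ConvexOn.add_inner_le {f : E → ℝ} {s : Set E} (hf : ConvexOn ℝ s f)
    {g w u : E} (h : HasGradientAt f g w) (hw : w ∈ s) (hu : u ∈ s) :
    f w + ⟪g, u - w⟫ ≤ f u := by
  simpa using (strongConvexOn_zero.2 hf).add_inner_le h hw hu

/-- A function that is Lipschitz only on a lower-dimensional set gives no bound on the norm of its
gradient. Only feasible directions are controlled, and mirror descent uses no others. -/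
theorem LipschitzOnWith.abs_inner_gradient_le {f : E → ℝ} {s : Set E} {K : NNReal}
    (hf : LipschitzOnWith K f s) (hs : Convex ℝ s) {g w u : E} (h : HasGradientAt f g w)
    (hw : w ∈ s) (hu : u ∈ s) : |⟪g, u - w⟫| ≤ K * ‖u - w‖ := by
  have key : ∀ t : ℝ, 0 < t → t < 1 → |f (w + t • (u - w)) - f w| ≤ t * (K * ‖u - w‖) := by
    intro t ht0 ht1
    have := hf.dist_le_mul _ (hs.add_smul_sub_mem hw hu ⟨ht0.le, ht1.le⟩) _ hw
    rw [Real.dist_eq, dist_eq_norm, add_sub_cancel_left, norm_smul, Real.norm_of_nonneg ht0.le]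
      at this
    linarith
  rw [abs_le]
  constructor
  · refine h.le_inner_of_forall_le fun t ht0 ht1 => ?_
    have := (abs_le.1 (key t ht0 ht1)).1
    linarith
  · exact h.inner_le_of_forall_le (c := fun _ => K * ‖u - w‖) (by fun_prop)
      fun t ht0 ht1 => (abs_le.1 (key t ht0 ht1)).2

theorem IsMinOn.inner_gradient_nonneg {f : E → ℝ} {s : Set E} {g w u : E} (hmin : IsMinOn f s w)
    (hs : Convex ℝ s) (h : HasGradientAt f g w) (hw : w ∈ s) (hu : u ∈ s) : 0 ≤ ⟪g, u - w⟫ := by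
  refine h.le_inner_of_forall_le fun t ht0 ht1 => ?_
  have := isMinOn_iff.1 hmin _ (hs.add_smul_sub_mem hw hu ⟨ht0.le, ht1.le⟩)
  linarith

end Convexity

namespace BetheMD

/-! ### The marginal polytope and the Bethe entropy -/

section Polytope

variable {V : Type*} [Fintype V] [DecidableEq V]
  {X : V → Type*} [∀ i, Fintype (X i)] [∀ i, DecidableEq (X i)] {𝒞 : Finset (Finset V)}

theorem suffStat_inl (y : (i : V) → X i) (i : V) (x : X i) :
    suffStat 𝒞 y (Sum.inl ⟨i, x⟩) = if y i = x then 1 else 0 := rfl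

theorem suffStat_inr (y : (i : V) → X i) (c : {c : Finset V // c ∈ 𝒞})
    (z : (i : {i : V // i ∈ c.1}) → X i.1) :
    suffStat 𝒞 y (Sum.inr ⟨c, z⟩) = if (fun i : {i : V // i ∈ c.1} => y i.1) = z then 1 else 0 :=
  rfl

theorem suffStat_eq_zero_or_one (y : (i : V) → X i) (k : Index X 𝒞) :
    suffStat 𝒞 y k = 0 ∨ suffStat 𝒞 y k = 1 := by
  rcases k with ⟨i, x⟩ | ⟨c, z⟩
  · rw [suffStat_inl]; split_ifs <;> simp
  · rw [suffStat_inr]; split_ifs <;> simp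

theorem suffStat_nonneg (y : (i : V) → X i) (k : Index X 𝒞) : 0 ≤ suffStat 𝒞 y k := by
  rcases suffStat_eq_zero_or_one y k with h | h <;> simp [h]

theorem exists_suffStat_eq_one [∀ i, Nonempty (X i)] (k : Index X 𝒞) :
    ∃ y, suffStat 𝒞 y k = 1 := by
  classical
  rcases k with ⟨i, x⟩ | ⟨c, z⟩
  · exact ⟨Function.update (fun _ => Classical.arbitrary _) i x, by simp [suffStat_inl]⟩
  · refine ⟨fun i => if h : i ∈ c.1 then z ⟨i, h⟩ else Classical.arbitrary _, ?_⟩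
    rw [suffStat_inr, if_pos]
    ext i
    simp

theorem meanStat_apply (P : ((i : V) → X i) → ℝ) (k : Index X 𝒞) :
    meanStat 𝒞 P k = ∑ y, P y * suffStat 𝒞 y k := by
  simp [meanStat]

theorem isLinearMap_meanStat :
    IsLinearMap ℝ (meanStat 𝒞 : (((i : V) → X i) → ℝ) → MargVec X 𝒞) where
  map_add P Q := by simp [meanStat, add_smul, Finset.sum_add_distrib]
  map_smul a P := by simp [meanStat, Finset.smul_sum, smul_smul]

theorem convex_marginalPolytope : Convex ℝ (marginalPolytope X 𝒞) :=
  (convex_stdSimplex ℝ _).is_linear_image isLinearMap_meanStat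

theorem isCompact_marginalPolytope : IsCompact (marginalPolytope X 𝒞) := by
  refine (isCompact_stdSimplex ℝ _).image ?_
  unfold meanStat
  fun_prop

theorem suffStat_mem (y : (i : V) → X i) : suffStat 𝒞 y ∈ marginalPolytope X 𝒞 := by
  classical
  refine ⟨Pi.single y 1, single_mem_stdSimplex ℝ y, ?_⟩
  simp [meanStat, Pi.single_apply]

theorem nonempty_marginalPolytope [∀ i, Nonempty (X i)] : (marginalPolytope X 𝒞).Nonempty :=
  ⟨_, suffStat_mem fun _ => Classical.arbitrary _⟩

theorem nonneg_of_mem {μ : MargVec X 𝒞} (hμ : μ ∈ marginalPolytope X 𝒞) (k : Index X 𝒞) :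
    0 ≤ μ k := by
  obtain ⟨P, hP, rfl⟩ := hμ
  rw [meanStat_apply]
  exact Finset.sum_nonneg fun y _ => mul_nonneg (hP.1 y) (suffStat_nonneg y k)

theorem meanStat_pos [∀ i, Nonempty (X i)] {P : ((i : V) → X i) → ℝ} (hP : ∀ y, 0 < P y)
    (k : Index X 𝒞) : 0 < meanStat 𝒞 P k := by
  obtain ⟨y, hy⟩ := exists_suffStat_eq_one k
  rw [meanStat_apply]
  refine Finset.sum_pos' (fun y _ => mul_nonneg (hP y).le (suffStat_nonneg y k))
    ⟨y, Finset.mem_univ _, ?_⟩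
  rw [hy, mul_one]
  exact hP y

/-- The number of cliques that contain a node. -/
def cliqueDegree (𝒞 : Finset (Finset V)) (i : V) : ℕ := (𝒞.filter fun c => i ∈ c).card

variable (𝒞) in
/-- The coefficient with which a coordinate enters the Bethe entropy. -/
def coef : Index X 𝒞 → ℝ
  | Sum.inl ⟨i, _⟩ => 1 - (cliqueDegree 𝒞 i : ℝ)
  | Sum.inr _ => 1

theorem betheEntropy_eq_sum (μ : MargVec X 𝒞) :
    betheEntropy 𝒞 μ = ∑ k, coef 𝒞 k * Real.negMulLog (μ k) := by
  simp only [betheEntropy, Fintype.sum_sum_type, Fintype.sum_sigma, coef, nodeEntropy,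
    cliqueEntropy, one_mul, ← Finset.mul_sum, cliqueDegree]
  rw [add_comm, sub_eq_add_neg, ← Finset.sum_neg_distrib]
  congr 1
  refine Finset.sum_congr rfl fun i _ => ?_
  ring

theorem continuous_betheEntropy :
    Continuous (betheEntropy 𝒞 : MargVec X 𝒞 → ℝ) := by
  have : (betheEntropy 𝒞 : MargVec X 𝒞 → ℝ) =
    fun μ => ∑ k, coef 𝒞 k * Real.negMulLog (μ k) := funext betheEntropy_eq_sum
  rw [this]
  fun_prop

/-- The gradient of the Bethe entropy. -/
def entropyGrad (μ : MargVec X 𝒞) : MargVec X 𝒞 :=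
  WithLp.toLp 2 fun k => coef 𝒞 k * (-Real.log (μ k) - 1)

theorem hasGradientAt_betheEntropy {μ : MargVec X 𝒞} (hμ : ∀ k, 0 < μ k) :
    HasGradientAt (betheEntropy 𝒞) (entropyGrad μ) μ := by
  have hE : (betheEntropy 𝒞 : MargVec X 𝒞 → ℝ) =
    fun μ => ∑ k, coef 𝒞 k * Real.negMulLog (μ k) := funext betheEntropy_eq_sum
  rw [hE, hasGradientAt_iff_hasFDerivAt]
  have hk : ∀ k ∈ (Finset.univ : Finset (Index X 𝒞)),
      HasFDerivAt (fun μ : MargVec X 𝒞 => coef 𝒞 k * Real.negMulLog (μ k))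
        (coef 𝒞 k • ((-Real.log (μ k) - 1) • (EuclideanSpace.proj k : MargVec X 𝒞 →L[ℝ] ℝ))) μ := by
    intro k _
    have h1 : HasFDerivAt (fun μ : MargVec X 𝒞 => μ k)
        (EuclideanSpace.proj k : MargVec X 𝒞 →L[ℝ] ℝ) μ :=
      (EuclideanSpace.proj k : MargVec X 𝒞 →L[ℝ] ℝ).hasFDerivAt
    exact ((Real.hasDerivAt_negMulLog (hμ k).ne').comp_hasFDerivAt μ h1).const_mul _
  refine (HasFDerivAt.fun_sum hk).congr_fderiv ?_
  ext v
  simp [entropyGrad, PiLp.inner_apply, mul_comm, mul_assoc]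

theorem gradient_betheEntropy {μ : MargVec X 𝒞} (hμ : ∀ k, 0 < μ k) :
    ∇ (betheEntropy 𝒞) μ = entropyGrad μ :=
  (hasGradientAt_betheEntropy hμ).gradient

/-- The Bregman divergence of the negative Bethe entropy. -/
def bregman (u w : MargVec X 𝒞) : ℝ :=
  betheEntropy 𝒞 w - betheEntropy 𝒞 u + ⟪entropyGrad w, u - w⟫

/-- A signed sum of generalized Kullback-Leibler terms. The node coefficients `1 - d_i` may be
negative, so nonnegativity cannot be read off here and comes from strong convexity instead. The form
serves coordinatewise upper bounds. -/
theorem bregman_eq_sum {u w : MargVec X 𝒞} (hw : ∀ k, 0 < w k) :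
    bregman u w = ∑ k, coef 𝒞 k * (w k * InformationTheory.klFun (u k / w k)) := by
  rw [bregman, betheEntropy_eq_sum, betheEntropy_eq_sum, PiLp.inner_apply,
    ← Finset.sum_sub_distrib, ← Finset.sum_add_distrib]
  refine Finset.sum_congr rfl fun k _ => ?_
  have hk := (hw k).ne'
  simp only [entropyGrad, Real.negMulLog, InformationTheory.klFun_apply, PiLp.sub_apply,
    RCLike.inner_apply, conj_trivial]
  rcases eq_or_ne (u k) 0 with h | h
  · simp only [h]; simp; ring
  · rw [Real.log_div h hk]
    field_simp
    ring

theorem bregman_lower_bound {lam : ℝ}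
    (hH : StrongConvexOn (marginalPolytope X 𝒞) lam (fun μ => -betheEntropy 𝒞 μ))
    {u w : MargVec X 𝒞} (hu : u ∈ marginalPolytope X 𝒞) (hw : w ∈ marginalPolytope X 𝒞)
    (hpos : ∀ k, 0 < w k) : lam / 2 * ‖u - w‖ ^ 2 ≤ bregman u w := by
  have hg : HasGradientAt (fun μ => -betheEntropy 𝒞 μ) (-entropyGrad w) w := by
    have := (hasGradientAt_betheEntropy hpos).hasFDerivAt.neg
    rw [hasGradientAt_iff_hasFDerivAt, map_neg]
    exact this
  have := hH.add_inner_le hg hw hu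
  rw [inner_neg_left] at this
  rw [bregman]
  linarith

end Polytope


/-! ### Minimizers of entropy-regularized objectives have positive coordinates -/

section Positivity

open Filter Topology

variable {V : Type*} [Fintype V] [DecidableEq V]
  {X : V → Type*} [∀ i, Fintype (X i)] [∀ i, DecidableEq (X i)] {𝒞 : Finset (Finset V)}

theorem sum_mul_suffStat (f : Index X 𝒞 → ℝ) (y : (i : V) → X i) :
    ∑ k, f k * suffStat 𝒞 y k =
      ∑ i, f (Sum.inl ⟨i, y i⟩) +
        ∑ c : {c : Finset V // c ∈ 𝒞}, f (Sum.inr ⟨c, fun i => y i.1⟩) := by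
  simp only [Fintype.sum_sum_type, Fintype.sum_sigma, suffStat_inl, suffStat_inr, mul_ite, mul_one,
    mul_zero, Finset.sum_ite_eq, Finset.mem_univ, if_true]

/-- A vanishing node state thus annihilates every clique state through it. In the slope computation
below these cliques contribute `d_i`, cancelling the `-d_i` of the node. -/
theorem meanStat_clique_le_node {P : ((i : V) → X i) → ℝ} (hP : ∀ y, 0 ≤ P y)
    (c : {c : Finset V // c ∈ 𝒞}) (y : (i : V) → X i) {i : V} (hi : i ∈ c.1) :
    meanStat 𝒞 P (Sum.inr ⟨c, fun j => y j.1⟩) ≤ meanStat 𝒞 P (Sum.inl ⟨i, y i⟩) := by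
  rw [meanStat_apply, meanStat_apply]
  refine Finset.sum_le_sum fun w _ => mul_le_mul_of_nonneg_left ?_ (hP w)
  rw [suffStat_inl, suffStat_inr]
  split_ifs with h1 h2 h2
  · exact le_rfl
  · exact absurd (congrFun h1 ⟨i, hi⟩) h2
  · exact zero_le_one
  · exact le_rfl

theorem cliqueDegree_eq_sum (i : V) :
    (cliqueDegree 𝒞 i : ℝ) = ∑ c : {c : Finset V // c ∈ 𝒞}, if i ∈ c.1 then 1 else 0 := by
  rw [cliqueDegree, Finset.sum_coe_sort 𝒞 (fun c => if i ∈ c then (1 : ℝ) else 0),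
    Finset.sum_boole]

open scoped Classical in
/-- From a point of the polytope with a vanishing coordinate, there is a vertex in whose direction
the Bethe entropy has infinite slope. -/
theorem exists_vertex_entropy_slope [∀ i, Nonempty (X i)] {μ : MargVec X 𝒞}
    (hμ : μ ∈ marginalPolytope X 𝒞) (h0 : ∃ k, μ k = 0) :
    ∃ y, 0 < ∑ k, (if μ k = 0 then coef 𝒞 k else 0) * suffStat 𝒞 y k := by
  obtain ⟨P, hP, rfl⟩ := hμ
  by_cases hnode : ∃ (i : V) (x : X i), meanStat 𝒞 P (Sum.inl ⟨i, x⟩) = 0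
  · obtain ⟨i, x, hix⟩ := hnode
    obtain ⟨y₀, hy₀⟩ : ∃ y, 0 < P y := by
      by_contra! hcon
      have : ∑ y, P y ≤ 0 := Finset.sum_nonpos fun y _ => hcon y
      rw [hP.2] at this
      linarith
    have hpos : ∀ k, suffStat 𝒞 y₀ k = 1 → meanStat 𝒞 P k ≠ 0 := by
      intro k hk
      rw [meanStat_apply]
      refine (Finset.sum_pos' (fun y _ => mul_nonneg (hP.1 y) (suffStat_nonneg y k))
        ⟨y₀, Finset.mem_univ _, ?_⟩).ne'
      rw [hk, mul_one]
      exact hy₀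
    -- Changing only node `i` of a configuration in the support, the vanishing coordinates met are
    -- node `i`, with coefficient `1 - d_i`, and the `d_i` cliques through `i`, with coefficient 1
    -- each. The total is exactly 1.
    refine ⟨Function.update y₀ i x, ?_⟩
    rw [sum_mul_suffStat]
    have h1 : ∀ j, (if meanStat 𝒞 P (Sum.inl ⟨j, Function.update y₀ i x j⟩) = 0 then
        coef 𝒞 (Sum.inl ⟨j, Function.update y₀ i x j⟩) else 0) =
        if j = i then 1 - (cliqueDegree 𝒞 i : ℝ) else 0 := by
      intro j
      by_cases hj : j = i
      · subst hj
        rw [Function.update_self, if_pos hix, if_pos rfl, coef]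
      · rw [Function.update_of_ne hj, if_neg hj, if_neg]
        exact hpos _ (by simp [suffStat_inl])
    have h2 : ∀ c : {c : Finset V // c ∈ 𝒞},
        (if meanStat 𝒞 P (Sum.inr ⟨c, fun j => Function.update y₀ i x j.1⟩) = 0 then
        coef 𝒞 (Sum.inr ⟨c, fun j => Function.update y₀ i x j.1⟩) else 0) =
        if i ∈ c.1 then 1 else 0 := by
      intro c
      by_cases hc : i ∈ c.1
      · have hle := meanStat_clique_le_node hP.1 c (Function.update y₀ i x) hc
        rw [Function.update_self, hix] at hle
        have hge := nonneg_of_mem (𝒞 := 𝒞) ⟨P, hP, rfl⟩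
          (Sum.inr ⟨c, fun j => Function.update y₀ i x j.1⟩)
        rw [if_pos (le_antisymm hle hge), if_pos hc, coef]
      · rw [if_neg hc, if_neg]
        refine hpos _ ?_
        rw [suffStat_inr, if_pos]
        ext j
        rw [Function.update_of_ne]
        rintro rfl
        exact hc j.2
    rw [Finset.sum_congr rfl fun j _ => h1 j, Finset.sum_congr rfl fun c _ => h2 c,
      ← cliqueDegree_eq_sum]
    simp
  -- Now only clique coordinates vanish, and these all have coefficient 1.
  · push Not at hnode
    obtain ⟨k, hk⟩ := h0
    obtain ⟨y, hy⟩ := exists_suffStat_eq_one k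
    refine ⟨y, ?_⟩
    have hterm : ∀ l, 0 ≤ (if meanStat 𝒞 P l = 0 then coef 𝒞 l else 0) * suffStat 𝒞 y l := by
      rintro (⟨i, x⟩ | l)
      · rw [if_neg (hnode i x), zero_mul]
      · refine mul_nonneg ?_ (suffStat_nonneg _ _)
        split_ifs <;> simp [coef]
    refine Finset.sum_pos' (fun l _ => hterm l) ⟨k, Finset.mem_univ _, ?_⟩
    rw [if_pos hk, hy, mul_one]
    rcases k with ⟨i, x⟩ | k
    · exact absurd hk (hnode i x)
    · simp [coef]

/-- A minimizer of the negative Bethe entropy plus a Lipschitz function has no vanishing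
coordinate. -/
theorem pos_of_isMinOn [∀ i, Nonempty (X i)] {φ : MargVec X 𝒞 → ℝ} {K : NNReal}
    (hφ : LipschitzOnWith K φ (marginalPolytope X 𝒞)) {μ : MargVec X 𝒞}
    (hμ : μ ∈ marginalPolytope X 𝒞)
    (hmin : IsMinOn (fun μ => -betheEntropy 𝒞 μ + φ μ) (marginalPolytope X 𝒞) μ)
    (k : Index X 𝒞) : 0 < μ k := by
  classical
  by_contra hk
  obtain ⟨y, hy⟩ := exists_vertex_entropy_slope hμ
    ⟨k, le_antisymm (not_lt.1 hk) (nonneg_of_mem hμ k)⟩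
  set b := ∑ k, (if μ k = 0 then coef 𝒞 k else 0) * suffStat 𝒞 y k with hb
  set v := suffStat 𝒞 y - μ with hv
  -- After removal of the `-log ε` part each difference quotient converges: at a vanishing
  -- coordinate the difference is identically 0, and at the others `-x log x` is differentiable.
  have hconv : ∀ k, ∃ q, Tendsto (fun ε : ℝ => coef 𝒞 k *
      (ε⁻¹ * (Real.negMulLog (μ k + ε * v k) - Real.negMulLog (μ k))) -
      (if μ k = 0 then coef 𝒞 k else 0) * suffStat 𝒞 y k * (-Real.log ε)) (𝓝[>] 0) (𝓝 q) := by
    intro k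
    by_cases h : μ k = 0
    · refine ⟨0, tendsto_const_nhds.congr' ?_⟩
      filter_upwards [self_mem_nhdsWithin] with ε hε
      have hε' : ε ≠ 0 := (Set.mem_Ioi.1 hε).ne'
      have hvk : v k = suffStat 𝒞 y k := by simp [hv, h]
      rw [if_pos h, h, hvk, zero_add, Real.negMulLog_zero, sub_zero]
      rcases suffStat_eq_zero_or_one y k with h1 | h1
      · simp [h1]
      · rw [h1, mul_one, mul_one, Real.negMulLog]
        field_simp
        ring
    · simp only [if_neg h, zero_mul, sub_zero]
      have h1 : HasDerivAt (fun ε : ℝ => μ k + ε * v k) (v k) 0 := by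
        simpa using ((hasDerivAt_id (0 : ℝ)).mul_const (v k)).const_add (μ k)
      have h2 : HasDerivAt Real.negMulLog (-Real.log (μ k) - 1) (μ k + 0 * v k) := by
        simpa using Real.hasDerivAt_negMulLog h
      have h3 := (h2.comp (0 : ℝ) h1).tendsto_slope_zero_right
      refine ⟨_, Tendsto.const_mul _ (h3.congr fun ε => ?_)⟩
      simp
  choose q hq using hconv
  have hsum := tendsto_finsetSum Finset.univ fun k _ => hq k
  have hlog : Tendsto (fun ε : ℝ => b * (-Real.log ε)) (𝓝[>] 0) atTop :=
    (tendsto_neg_atBot_atTop.comp Real.tendsto_log_nhdsGT_zero).const_mul_atTop hy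
  have hall := hlog.atTop_add hsum
  have hev : ∀ᶠ ε : ℝ in 𝓝[>] 0, b * (-Real.log ε) + ∑ k, (coef 𝒞 k *
      (ε⁻¹ * (Real.negMulLog (μ k + ε * v k) - Real.negMulLog (μ k))) -
      (if μ k = 0 then coef 𝒞 k else 0) * suffStat 𝒞 y k * (-Real.log ε)) ≤ K * ‖v‖ := by
    filter_upwards [Ioo_mem_nhdsGT (zero_lt_one' ℝ)] with ε hε
    rw [Finset.sum_sub_distrib, ← Finset.sum_mul, ← hb, add_sub_cancel]
    have hmem := convex_marginalPolytope.add_smul_sub_mem hμ (suffStat_mem y) ⟨hε.1.le, hε.2.le⟩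
    have h1 := isMinOn_iff.1 hmin _ hmem
    have h2 := hφ.dist_le_mul _ hmem _ hμ
    rw [← hv] at h1 h2
    rw [Real.dist_eq, dist_eq_norm, add_sub_cancel_left, norm_smul, Real.norm_of_nonneg hε.1.le]
      at h2
    have h3 := le_of_abs_le h2
    have h4 : betheEntropy 𝒞 (μ + ε • v) - betheEntropy 𝒞 μ ≤ ε * (K * ‖v‖) := by
      linarith
    have h5 : ∑ k, coef 𝒞 k *
        (ε⁻¹ * (Real.negMulLog (μ k + ε * v k) - Real.negMulLog (μ k))) =
        ε⁻¹ * (betheEntropy 𝒞 (μ + ε • v) - betheEntropy 𝒞 μ) := by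
      rw [betheEntropy_eq_sum, betheEntropy_eq_sum, ← Finset.sum_sub_distrib, Finset.mul_sum]
      refine Finset.sum_congr rfl fun k _ => ?_
      simp only [PiLp.add_apply, PiLp.smul_apply, smul_eq_mul]
      ring
    rw [h5, inv_mul_le_iff₀ hε.1]
    exact h4
  obtain ⟨ε, h1, h2⟩ := (hev.and (hall.eventually_gt_atTop (K * ‖v‖))).exists
  linarith

end Positivity


/-! ### Forest-structured Gibbs distributions factorize over their marginals -/

section Forest

variable {V : Type*} [Fintype V] [DecidableEq V]
  {X : V → Type*} [∀ i, Fintype (X i)] [∀ i, DecidableEq (X i)]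

/-- The indicator that two configurations agree on a set of nodes. -/
def agree (T : Finset V) (y y' : (i : V) → X i) : ℝ := if ∀ i ∈ T, y' i = y i then 1 else 0

/-- The marginal on a set of nodes of a weight function on configurations, as a function of the
configuration. -/
def marg (T : Finset V) (f : ((i : V) → X i) → ℝ) (y : (i : V) → X i) : ℝ :=
  ∑ y', agree T y y' * f y'

theorem agree_nonneg (T : Finset V) (y y' : (i : V) → X i) : 0 ≤ agree T y y' := by
  unfold agree; split_ifs <;> norm_num

theorem agree_self (T : Finset V) (y : (i : V) → X i) : agree T y y = 1 := by simp [agree]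

theorem sum_agree_mul_pos (T : Finset V) {f : ((i : V) → X i) → ℝ} (hf : ∀ y, 0 < f y)
    (y : (i : V) → X i) : 0 < ∑ y', agree T y y' * f y' := by
  refine Finset.sum_pos' (fun y' _ => mul_nonneg (agree_nonneg _ _ _) (hf y').le)
    ⟨y, Finset.mem_univ _, ?_⟩
  rw [agree_self, one_mul]
  exact hf y

theorem marg_pos (T : Finset V) {f : ((i : V) → X i) → ℝ} (hf : ∀ y, 0 < f y)
    (y : (i : V) → X i) : 0 < marg T f y := sum_agree_mul_pos T hf y

theorem dependsOn_agree (T : Finset V) (y : (i : V) → X i) : DependsOn (agree T y) (T : Set V) := by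
  intro y₁ y₂ h
  unfold agree
  refine if_congr ?_ rfl rfl
  exact forall₂_congr fun i hi => by rw [h i (Finset.mem_coe.2 hi)]

theorem agree_pair (u v : V) (y y' : (i : V) → X i) :
    agree {u, v} y y' = agree {u} y y' * agree {v} y y' := by
  simp only [agree, Finset.mem_insert, Finset.mem_singleton, forall_eq_or_imp, forall_eq]
  split_ifs <;> simp_all

theorem agree_mul_of_dependsOn {T : Finset V} {f : ((i : V) → X i) → ℝ}
    (hf : DependsOn f (T : Set V)) (y y' : (i : V) → X i) :
    agree T y y' * f y' = agree T y y' * f y := by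
  unfold agree
  split_ifs with h
  · rw [hf fun i hi => h i (Finset.mem_coe.1 hi)]
  · simp

theorem DependsOn.mul' {f g : ((i : V) → X i) → ℝ} {s : Set V} (hf : DependsOn f s)
    (hg : DependsOn g s) : DependsOn (fun y => f y * g y) s :=
  fun _ _ h => congrArg₂ (· * ·) (hf h) (hg h)

/-- Exchanging the coordinates outside a set between two configurations. -/
theorem sum_sum_piecewise (S : Finset V) (F : ((i : V) → X i) → ((i : V) → X i) → ℝ) :
    ∑ y, ∑ y', F y y' = ∑ y, ∑ y', F (S.piecewise y y') (S.piecewise y' y) := by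
  rw [← Fintype.sum_prod_type', ← Fintype.sum_prod_type']
  have hinv : Function.Involutive fun p : ((i : V) → X i) × ((i : V) → X i) =>
      (S.piecewise p.1 p.2, S.piecewise p.2 p.1) := by
    rintro ⟨y, y'⟩
    ext i <;> by_cases hi : i ∈ S <;> simp [hi]
  exact (Equiv.sum_comp hinv.toPerm fun p => F p.1 p.2).symm

/-- All sums run over complete configurations, so summing out the coordinates outside `S` separately
costs a factor, the number of configurations. This avoids handling partial configurations. -/
theorem card_mul_sum_mul_left {S : Finset V} {f : ((i : V) → X i) → ℝ}
    (hf : DependsOn f (S : Set V)) (h : ((i : V) → X i) → ℝ) :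
    (Fintype.card ((i : V) → X i) : ℝ) * ∑ y, f y * h y =
      ∑ y, f y * ∑ y', h (S.piecewise y y') := by
  have h1 : (Fintype.card ((i : V) → X i) : ℝ) * ∑ y, f y * h y =
      ∑ y, ∑ _y' : (i : V) → X i, f y * h y := by
    simp [Finset.mul_sum]
  rw [h1, sum_sum_piecewise S]
  refine Finset.sum_congr rfl fun y _ => ?_
  rw [Finset.mul_sum]
  refine Finset.sum_congr rfl fun y' _ => ?_
  congr 1
  exact hf fun i hi => Finset.piecewise_eq_of_mem _ _ _ (Finset.mem_coe.1 hi)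

theorem card_mul_sum_mul_right {S : Finset V} {g : ((i : V) → X i) → ℝ}
    (hg : DependsOn g ((Sᶜ : Finset V) : Set V)) (h : ((i : V) → X i) → ℝ) :
    (Fintype.card ((i : V) → X i) : ℝ) * ∑ y, g y * h y =
      ∑ y', g y' * ∑ y, h (S.piecewise y y') := by
  rw [card_mul_sum_mul_left hg]
  simp only [Finset.piecewise_compl]

theorem card_mul_sum_mul_of_dependsOn {S : Finset V} {f g : ((i : V) → X i) → ℝ}
    (hf : DependsOn f (S : Set V)) (hg : DependsOn g ((Sᶜ : Finset V) : Set V)) :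
    (Fintype.card ((i : V) → X i) : ℝ) * ∑ y, f y * g y = (∑ y, f y) * ∑ y, g y := by
  rw [card_mul_sum_mul_left hf, Finset.sum_mul]
  refine Finset.sum_congr rfl fun y _ => ?_
  congr 1
  refine Finset.sum_congr rfl fun y' _ => hg fun i hi => ?_
  exact Finset.piecewise_eq_of_notMem _ _ _ (Finset.mem_compl.1 (Finset.mem_coe.1 hi))

/-- Swapping the states `y i` and `w i` at node `i` is a bijection of configurations. This makes the
constant in the product case independent of the configuration. -/
theorem sum_agree_singleton (i : V) (y w : (i : V) → X i) :
    ∑ y', agree {i} y y' = ∑ y', agree {i} w y' := by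
  refine Fintype.sum_equiv
    (Equiv.piCongrRight fun j => if h : j = i then Equiv.swap (y j) (w j) else Equiv.refl _) _ _ ?_
  intro y'
  simp only [agree, Finset.mem_singleton, forall_eq]
  refine if_congr ?_ rfl rfl
  simp only [Equiv.piCongrRight_apply, Pi.map_apply, dif_pos]
  rw [Equiv.swap_apply_eq_iff, Equiv.swap_apply_right]

/-- Splitting a weight function along a pair factor which connects two otherwise independent
halves: the factor can be replaced by two node factors without changing the marginals in either
half, and it is, up to a constant, the ratio of the pair marginal to the node marginals times these
node factors. -/
theorem exists_split_pair {S : Finset V} {u v : V} (hu : u ∈ S) (hv : v ∉ S)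
    {P A b B : ((i : V) → X i) → ℝ} (hA : DependsOn A (S : Set V))
    (hB : DependsOn B ((Sᶜ : Finset V) : Set V)) (hb : DependsOn b (({u, v} : Finset V) : Set V))
    (hA0 : ∀ y, 0 < A y) (hB0 : ∀ y, 0 < B y) (hb0 : ∀ y, 0 < b y)
    (hP : ∀ y, P y = A y * b y * B y) (hP1 : ∑ y, P y = 1) :
    ∃ α β : ((i : V) → X i) → ℝ, DependsOn β {u} ∧ DependsOn α {v} ∧ (∀ y, 0 < α y) ∧
      (∀ y, 0 < β y) ∧
      (∀ T : Finset V, T ⊆ S ∨ T ⊆ Sᶜ → ∀ y, marg T (fun y =>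
        (Fintype.card ((i : V) → X i) : ℝ)⁻¹ * (A y * β y * (B y * α y))) y = marg T P y) ∧
      ∀ y, marg {u, v} P y * (α y * β y) =
        (Fintype.card ((i : V) → X i) : ℝ) * b y * (marg {u} P y * marg {v} P y) := by
  have hne : Nonempty ((i : V) → X i) := by
    by_contra hcon
    rw [not_nonempty_iff] at hcon
    simp at hP1
  set N : ℝ := (Fintype.card ((i : V) → X i) : ℝ) with hN
  have hN0 : N ≠ 0 := by
    rw [hN]; exact_mod_cast Fintype.card_ne_zero
  -- The two sum-product messages across the pair factor: `β` sums out the side of `v` and depends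
  -- on `u` alone; `α` sums out the side of `u` and depends on `v` alone.
  set β : ((i : V) → X i) → ℝ := fun y => ∑ y', b (S.piecewise y y') * B y' with hβ
  set α : ((i : V) → X i) → ℝ := fun y' => ∑ y, A y * b (S.piecewise y y') with hα
  have hBpw : ∀ y y', B (S.piecewise y y') = B y' := fun y y' => hB fun i hi =>
    Finset.piecewise_eq_of_notMem _ _ _ (Finset.mem_compl.1 (Finset.mem_coe.1 hi))
  have hApw : ∀ y y', A (S.piecewise y y') = A y := fun y y' => hA fun i hi =>
    Finset.piecewise_eq_of_mem _ _ _ (Finset.mem_coe.1 hi)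
  have hβd : DependsOn β {u} := by
    intro y₁ y₂ h
    refine Finset.sum_congr rfl fun y' _ => ?_
    congr 1
    refine hb fun i hi => ?_
    rcases Finset.mem_insert.1 (Finset.mem_coe.1 hi) with rfl | hi
    · simpa [hu] using h
    · rw [Finset.mem_singleton.1 hi]
      simp [hv]
  have hαd : DependsOn α {v} := by
    intro y₁ y₂ h
    refine Finset.sum_congr rfl fun y' _ => ?_
    congr 1
    refine hb fun i hi => ?_
    rcases Finset.mem_insert.1 (Finset.mem_coe.1 hi) with rfl | hi
    · simp [hu]
    · rw [Finset.mem_singleton.1 hi]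
      simpa [hv] using h
  have hβS : DependsOn β (S : Set V) := hβd.mono (by simpa using hu)
  have hαS : DependsOn α ((Sᶜ : Finset V) : Set V) := hαd.mono (by simpa using hv)
  have hleft : ∀ f : ((i : V) → X i) → ℝ, DependsOn f (S : Set V) →
      N * ∑ y, f y * P y = ∑ y, f y * (A y * β y) := by
    intro f hf
    have h1 : ∑ y, f y * P y = ∑ y, (f y * A y) * (b y * B y) :=
      Finset.sum_congr rfl fun y _ => by rw [hP]; ring
    rw [h1, hN, card_mul_sum_mul_left (DependsOn.mul' hf hA)]
    refine Finset.sum_congr rfl fun y _ => ?_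
    simp only [hBpw, hβ]
    ring
  have hright : ∀ g : ((i : V) → X i) → ℝ, DependsOn g ((Sᶜ : Finset V) : Set V) →
      N * ∑ y, g y * P y = ∑ y, g y * (B y * α y) := by
    intro g hg
    have h1 : ∑ y, g y * P y = ∑ y, (g y * B y) * (A y * b y) :=
      Finset.sum_congr rfl fun y _ => by rw [hP]; ring
    rw [h1, hN, card_mul_sum_mul_right (DependsOn.mul' hg hB)]
    refine Finset.sum_congr rfl fun y _ => ?_
    simp only [hApw, hα]
    ring
  have hAβ : ∑ y, A y * β y = N := by
    have := hleft (fun _ => 1) (fun _ _ _ => rfl)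
    simpa [hP1] using this.symm
  have hBα : ∑ y, B y * α y = N := by
    have := hright (fun _ => 1) (fun _ _ _ => rfl)
    simpa [hP1] using this.symm
  refine ⟨α, β, hβd, hαd, fun y => Finset.sum_pos (fun y' _ => mul_pos (hA0 _) (hb0 _))
    Finset.univ_nonempty, fun y => Finset.sum_pos (fun y' _ => mul_pos (hb0 _) (hB0 _))
    Finset.univ_nonempty, ?_, ?_⟩
  · rintro T (hT | hT) y
    · have hd : DependsOn (agree T y) (S : Set V) :=
        (dependsOn_agree T y).mono (Finset.coe_subset.2 hT)
      have h1 := card_mul_sum_mul_of_dependsOn (DependsOn.mul' hd (DependsOn.mul' hA hβS))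
        (DependsOn.mul' hB hαS)
      rw [hBα, ← hleft _ hd, ← hN] at h1
      have h2 : marg T (fun y => N⁻¹ * (A y * β y * (B y * α y))) y =
          N⁻¹ * ∑ y', agree T y y' * (A y' * β y') * (B y' * α y') := by
        rw [marg, Finset.mul_sum]
        exact Finset.sum_congr rfl fun y' _ => by ring
      rw [h2, marg]
      field_simp at h1 ⊢
      linarith
    · have hd : DependsOn (agree T y) ((Sᶜ : Finset V) : Set V) :=
        (dependsOn_agree T y).mono (Finset.coe_subset.2 hT)
      have h1 := card_mul_sum_mul_of_dependsOn (DependsOn.mul' hA hβS)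
        (DependsOn.mul' hd (DependsOn.mul' hB hαS))
      rw [hAβ, ← hright _ hd, ← hN] at h1
      have h2 : marg T (fun y => N⁻¹ * (A y * β y * (B y * α y))) y =
          N⁻¹ * ∑ y', A y' * β y' * (agree T y y' * (B y' * α y')) := by
        rw [marg, Finset.mul_sum]
        exact Finset.sum_congr rfl fun y' _ => by ring
      rw [h2, marg]
      field_simp at h1 ⊢
      linarith
  · intro y
    have hdu : DependsOn (agree {u} y) (S : Set V) :=
      (dependsOn_agree {u} y).mono (by simpa using hu)
    have hdv : DependsOn (agree {v} y) ((Sᶜ : Finset V) : Set V) :=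
      (dependsOn_agree {v} y).mono (by simpa using hv)
    have hmu : N * marg {u} P y = β y * ∑ y', agree {u} y y' * A y' := by
      rw [marg, hleft _ hdu, Finset.mul_sum]
      refine Finset.sum_congr rfl fun y' _ => ?_
      have := agree_mul_of_dependsOn (T := {u}) (by simpa using hβd) y y'
      linear_combination A y' * this
    have hmv : N * marg {v} P y = α y * ∑ y', agree {v} y y' * B y' := by
      rw [marg, hright _ hdv, Finset.mul_sum]
      refine Finset.sum_congr rfl fun y' _ => ?_
      have := agree_mul_of_dependsOn (T := {v}) (by simpa using hαd) y y'
      linear_combination B y' * this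
    have hme : N * marg {u, v} P y =
        b y * ((∑ y', agree {u} y y' * A y') * ∑ y', agree {v} y y' * B y') := by
      rw [← card_mul_sum_mul_of_dependsOn (DependsOn.mul' hdu hA) (DependsOn.mul' hdv hB), ← hN,
        mul_left_comm, marg, Finset.mul_sum (a := b y)]
      congr 1
      refine Finset.sum_congr rfl fun y' _ => ?_
      have := agree_mul_of_dependsOn hb y y'
      rw [hP]
      have h2 := agree_pair u v y y'
      linear_combination A y' * B y' * this + A y' * B y' * b y * h2
    have : N * (marg {u, v} P y * (α y * β y)) =
        N * (N * b y * (marg {u} P y * marg {v} P y)) := by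
      linear_combination (α y * β y) * hme - b y * (N * marg {v} P y) * hmu -
        b y * (β y * ∑ y', agree {u} y y' * A y') * hmv
    exact mul_left_cancel₀ hN0 this



/-- Removing an edge `{u, v}` of a forest leaves a forest, whose edges do not cross some set that
separates `u` from `v`. -/
theorem IsTreeStructured.exists_erase {E : Finset (Finset V)} (hE : IsTreeStructured E)
    {e : Finset V} (he : e ∈ E) :
    ∃ (u v : V) (S : Finset V), e = {u, v} ∧ u ∈ S ∧ v ∉ S ∧ IsTreeStructured (E.erase e) ∧
      ∀ c ∈ E.erase e, c ⊆ S ∨ c ⊆ Sᶜ := by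
  classical
  obtain ⟨G, hG, hEG⟩ := hE
  obtain ⟨u, v, huv, rfl⟩ := (hEG e).1 he
  have hbr := SimpleGraph.isBridge_iff.1
    (SimpleGraph.isAcyclic_iff_forall_isBridge.1 hG (G.mem_edgeSet.2 huv))
  set G' := G.deleteEdges {s(u, v)} with hG'
  have hpair : ∀ a b : V, ({a, b} : Finset V) = {u, v} ↔ s(a, b) = s(u, v) := by
    intro a b
    rw [Sym2.eq_iff, ← Finset.coe_inj]
    simp [Set.pair_eq_pair_iff]
  have hadj : ∀ c : Finset V, c ∈ E.erase {u, v} ↔ ∃ a b, G'.Adj a b ∧ c = {a, b} := by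
    intro c
    rw [Finset.mem_erase, hEG]
    constructor
    · rintro ⟨hne, a, b, hab, rfl⟩
      exact ⟨a, b, by simp only [hG', SimpleGraph.deleteEdges_adj, Set.mem_singleton_iff]
                      exact ⟨hab, fun h => hne ((hpair a b).2 h)⟩, rfl⟩
    · rintro ⟨a, b, hab, rfl⟩
      simp only [hG', SimpleGraph.deleteEdges_adj, Set.mem_singleton_iff] at hab
      exact ⟨fun h => hab.2 ((hpair a b).1 h), a, b, hab.1, rfl⟩
  -- The separating set is the component of `u` after deletion of the edge. It misses `v` because
  -- every edge of a forest is a bridge.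
  refine ⟨u, v, Finset.univ.filter fun w => G'.Reachable u w, rfl, by simp, by simpa using hbr,
    ⟨G', hG.anti (G.deleteEdges_le _), hadj⟩, ?_⟩
  intro c hc
  obtain ⟨a, b, hab, rfl⟩ := (hadj c).1 hc
  by_cases ha : G'.Reachable u a
  · left
    intro w hw
    rcases Finset.mem_insert.1 hw with rfl | hw
    · simpa using ha
    · rw [Finset.mem_singleton.1 hw]
      simpa using ha.trans hab.reachable
  · right
    intro w hw
    rcases Finset.mem_insert.1 hw with rfl | hw
    · simpa using ha
    · rw [Finset.mem_singleton.1 hw]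
      simpa using fun h : G'.Reachable u b => ha (h.trans hab.symm.reachable)

/-- A product distribution is, up to a constant, the product of its node marginals. -/
theorem exists_log_eq_sum_log_marg_of_product {P : ((i : V) → X i) → ℝ} (hP1 : ∑ y, P y = 1)
    {κ : ℝ} {a : V → ((i : V) → X i) → ℝ} (ha : ∀ i, DependsOn (a i) {i})
    (hP : ∀ y, P y = Real.exp (κ + ∑ i, a i y)) :
    ∃ κ', ∀ y, Real.log (P y) = κ' + ∑ i, Real.log (marg {i} P y) := by
  have hne : Nonempty ((i : V) → X i) := by
    by_contra hcon
    rw [not_nonempty_iff] at hcon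
    simp at hP1
  obtain ⟨w⟩ := hne
  set N : ℝ := (Fintype.card ((i : V) → X i) : ℝ) with hN
  have hN0 : 0 < N := by
    have : Nonempty ((i : V) → X i) := ⟨w⟩
    rw [hN]; exact_mod_cast Fintype.card_pos
  -- All factors except that of node `i`, so that the marginal at `i` is the factor of `i` times a
  -- constant.
  set r : V → ((i : V) → X i) → ℝ := fun i y => Real.exp (κ + ∑ j ∈ Finset.univ.erase i, a j y)
  have hr : ∀ i y, P y = Real.exp (a i y) * r i y := by
    intro i y
    rw [hP, ← Real.exp_add, ← Finset.add_sum_erase _ _ (Finset.mem_univ i)]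
    congr 1
    ring
  have hrd : ∀ i, DependsOn (r i) ((({i} : Finset V)ᶜ : Finset V) : Set V) := by
    intro i y₁ y₂ h
    have : ∀ j ∈ Finset.univ.erase i, a j y₁ = a j y₂ := by
      intro j hj
      refine ha j fun l hl => h l ?_
      rw [Set.mem_singleton_iff.1 hl]
      simpa using Finset.ne_of_mem_erase hj
    simp only [r, Finset.sum_congr rfl this]
  have hm : ∀ i y, N * marg {i} P y =
      Real.exp (a i y) * ((∑ y', agree {i} w y') * ∑ y', r i y') := by
    intro i y
    have hd : DependsOn (agree {i} y) (({i} : Finset V) : Set V) := dependsOn_agree {i} y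
    rw [sum_agree_singleton i w y, ← card_mul_sum_mul_of_dependsOn hd (hrd i), ← hN,
      mul_left_comm, marg, Finset.mul_sum (a := Real.exp (a i y))]
    congr 1
    refine Finset.sum_congr rfl fun y' _ => ?_
    have := agree_mul_of_dependsOn (T := {i}) (f := fun y => Real.exp (a i y))
      (fun y₁ y₂ h => congrArg Real.exp (ha i (by simpa using h))) y y'
    rw [hr i]
    linear_combination r i y' * this
  refine ⟨κ - ∑ i, Real.log (N⁻¹ * ((∑ y', agree {i} w y') * ∑ y', r i y')), fun y => ?_⟩
  have hlog : ∀ i, Real.log (marg {i} P y) =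
      a i y + Real.log (N⁻¹ * ((∑ y', agree {i} w y') * ∑ y', r i y')) := by
    intro i
    have h1 : marg {i} P y =
        Real.exp (a i y) * (N⁻¹ * ((∑ y', agree {i} w y') * ∑ y', r i y')) := by
      have := hm i y
      field_simp
      linarith
    have h2 : 0 < ∑ y', agree {i} w y' := by
      simpa using sum_agree_mul_pos {i} (f := fun _ => 1) (fun _ => one_pos) w
    have h3 : 0 < ∑ y', r i y' :=
      Finset.sum_pos (fun y' _ => Real.exp_pos _) ⟨w, Finset.mem_univ _⟩
    rw [h1, Real.log_mul (Real.exp_pos _).ne' (by positivity), Real.log_exp]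
  rw [Finset.sum_congr rfl fun i _ => hlog i, hP, Real.log_exp, Finset.sum_add_distrib]
  ring

/-- A positive distribution which is a product of node and edge factors of a forest is, up to a
constant, `∏_c P_c ∏_i P_i ^ (1 - d_i)`. -/
theorem exists_log_eq_sum_log_marg {E : Finset (Finset V)} (hE : IsTreeStructured E)
    {P : ((i : V) → X i) → ℝ} (hP1 : ∑ y, P y = 1) {κ : ℝ}
    {a : V → ((i : V) → X i) → ℝ} {b : Finset V → ((i : V) → X i) → ℝ}
    (ha : ∀ i, DependsOn (a i) {i}) (hb : ∀ c, DependsOn (b c) (c : Set V))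
    (hP : ∀ y, P y = Real.exp (κ + ∑ i, a i y + ∑ c ∈ E, b c y)) :
    ∃ κ', ∀ y, Real.log (P y) = κ' + ∑ c ∈ E, Real.log (marg c P y) +
      ∑ i, (1 - (cliqueDegree E i : ℝ)) * Real.log (marg {i} P y) := by
  induction hn : E.card generalizing E P κ a with
  | zero =>
    obtain rfl := Finset.card_eq_zero.1 hn
    obtain ⟨κ', h⟩ := exists_log_eq_sum_log_marg_of_product hP1 ha (κ := κ)
      (fun y => by simpa using hP y)
    exact ⟨κ', fun y => by simpa [cliqueDegree] using h y⟩
  | succ n ih =>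
    obtain ⟨e, he⟩ : E.Nonempty := Finset.card_pos.1 (by omega)
    obtain ⟨u, v, S, rfl, hu, hv, hE', hcross⟩ := hE.exists_erase he
    set e : Finset V := {u, v} with he_def
    set A : ((i : V) → X i) → ℝ := fun y =>
      Real.exp (κ + ∑ i ∈ S, a i y + ∑ c ∈ (E.erase e).filter (· ⊆ S), b c y)
    set B : ((i : V) → X i) → ℝ := fun y =>
      Real.exp (∑ i ∈ Sᶜ, a i y + ∑ c ∈ (E.erase e).filter (¬ · ⊆ S), b c y)
    have hAB : ∀ y, A y * B y =
        Real.exp (κ + ∑ i, a i y + ∑ c ∈ E.erase e, b c y) := by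
      intro y
      rw [← Real.exp_add, ← Finset.sum_add_sum_compl S,
        ← Finset.sum_filter_add_sum_filter_not (E.erase e) (· ⊆ S)]
      congr 1
      ring
    have hPAB : ∀ y, P y = A y * Real.exp (b e y) * B y := by
      intro y
      rw [mul_right_comm, hAB, ← Real.exp_add, hP, ← Finset.add_sum_erase _ _ he]
      congr 1
      ring
    have hA : DependsOn A (S : Set V) := by
      intro y₁ y₂ h
      have h1 : ∑ i ∈ S, a i y₁ = ∑ i ∈ S, a i y₂ := Finset.sum_congr rfl fun i hi =>
        ha i fun j hj => h j (by rw [Set.mem_singleton_iff.1 hj]; exact hi)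
      have h2 : ∑ c ∈ (E.erase e).filter (· ⊆ S), b c y₁ =
          ∑ c ∈ (E.erase e).filter (· ⊆ S), b c y₂ := Finset.sum_congr rfl fun c hc =>
        hb c fun j hj => h j ((Finset.mem_filter.1 hc).2 hj)
      simp only [A, h1, h2]
    have hB : DependsOn B ((Sᶜ : Finset V) : Set V) := by
      intro y₁ y₂ h
      have h1 : ∑ i ∈ Sᶜ, a i y₁ = ∑ i ∈ Sᶜ, a i y₂ := Finset.sum_congr rfl fun i hi =>
        ha i fun j hj => h j (by rw [Set.mem_singleton_iff.1 hj]; exact hi)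
      have h2 : ∑ c ∈ (E.erase e).filter (¬ · ⊆ S), b c y₁ =
          ∑ c ∈ (E.erase e).filter (¬ · ⊆ S), b c y₂ := Finset.sum_congr rfl fun c hc =>
        hb c fun j hj => h j
          (((hcross c (Finset.mem_filter.1 hc).1).resolve_left (Finset.mem_filter.1 hc).2) hj)
      simp only [B, h1, h2]
    obtain ⟨α, β, hβd, hαd, hα0, hβ0, hmarg, hpair⟩ := exists_split_pair hu hv hA hB
      (b := fun y => Real.exp (b e y)) (fun y₁ y₂ h => congrArg Real.exp (hb e h))
      (fun _ => Real.exp_pos _) (fun _ => Real.exp_pos _) (fun _ => Real.exp_pos _) hPAB hP1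
    have hne : Nonempty ((i : V) → X i) := by
      by_contra hcon
      rw [not_nonempty_iff] at hcon
      simp at hP1
    set N : ℝ := (Fintype.card ((i : V) → X i) : ℝ) with hN
    have hN0 : 0 < N := by
      rw [hN]; exact_mod_cast Fintype.card_pos
    have huv : u ≠ v := fun h => hv (h ▸ hu)
    have hP0 : ∀ y, 0 < P y := fun y => by rw [hP]; exact Real.exp_pos _
    -- The induction hypothesis is applied to this distribution, in which two node factors replace
    -- the factor of `e`: it has one edge fewer and the same node and remaining edge marginals as
    -- `P`.
    set P' : ((i : V) → X i) → ℝ := fun y => N⁻¹ * (A y * β y * (B y * α y)) with hP'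
    -- The marginal on the empty set is the total mass.
    have hP'1 : ∑ y, P' y = 1 := by
      obtain ⟨w⟩ := hne
      have := hmarg ∅ (Or.inl (Finset.empty_subset _)) w
      simpa [marg, agree, hP1] using this
    have hP'e : ∀ y, P' y = Real.exp ((κ - Real.log N) +
        ∑ i, (a i y + (if i = u then Real.log (β y) else 0) +
          (if i = v then Real.log (α y) else 0)) + ∑ c ∈ E.erase e, b c y) := by
      intro y
      simp only [Finset.sum_add_distrib, Finset.sum_ite_eq', Finset.mem_univ, if_true]
      have h1 : P' y = N⁻¹ * (β y * (α y * (A y * B y))) := by rw [hP']; ring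
      rw [h1, hAB]
      nth_rewrite 1 [← Real.exp_log hN0, ← Real.exp_log (hβ0 y), ← Real.exp_log (hα0 y)]
      rw [← Real.exp_neg, ← Real.exp_add, ← Real.exp_add, ← Real.exp_add]
      congr 1
      ring
    obtain ⟨κ', hκ'⟩ := ih hE' hP'1 (a := fun i y => a i y +
        (if i = u then Real.log (β y) else 0) + (if i = v then Real.log (α y) else 0))
      (by
        intro i y₁ y₂ h
        have h1 : (if i = u then Real.log (β y₁) else 0) =
            (if i = u then Real.log (β y₂) else 0) := by
          split_ifs with hi
          · subst hi; rw [hβd h]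
          · rfl
        have h2 : (if i = v then Real.log (α y₁) else 0) =
            (if i = v then Real.log (α y₂) else 0) := by
          split_ifs with hi
          · subst hi; rw [hαd h]
          · rfl
        simp only [ha i h, h1, h2]) hP'e (by rw [Finset.card_erase_of_mem he, hn]; rfl)
    have hdeg : ∀ i, (cliqueDegree E i : ℝ) = cliqueDegree (E.erase e) i +
        ((if i = u then 1 else 0) + (if i = v then 1 else 0)) := by
      intro i
      have h1 : ∀ F : Finset (Finset V), (cliqueDegree F i : ℝ) =
          ∑ c ∈ F, if i ∈ c then 1 else 0 := fun F => by rw [cliqueDegree, Finset.sum_boole]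
      rw [h1, h1, ← Finset.add_sum_erase _ _ he, add_comm]
      congr 1
      by_cases hiu : i = u
      · subst hiu; simp [he_def, huv]
      · simp [he_def, hiu]
    refine ⟨κ' , fun y => ?_⟩
    have hc : ∑ c ∈ E.erase e, Real.log (marg c P' y) = ∑ c ∈ E.erase e, Real.log (marg c P y) :=
      Finset.sum_congr rfl fun c hc => by rw [hP', hmarg c (hcross c hc)]
    have hi : ∀ i, marg {i} P' y = marg {i} P y := fun i => by
      refine hmarg {i} ?_ y
      by_cases h : i ∈ S <;> simp [h]
    have hsum : ∑ i, (1 - (cliqueDegree E i : ℝ)) * Real.log (marg {i} P y) =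
        ∑ i, (1 - (cliqueDegree (E.erase e) i : ℝ)) * Real.log (marg {i} P y) -
          (Real.log (marg {u} P y) + Real.log (marg {v} P y)) := by
      simp only [hdeg]
      have : ∀ i : V, (1 - ((cliqueDegree (E.erase e) i : ℝ) +
          ((if i = u then 1 else 0) + (if i = v then 1 else 0)))) * Real.log (marg {i} P y) =
          (1 - (cliqueDegree (E.erase e) i : ℝ)) * Real.log (marg {i} P y) -
          ((if i = u then Real.log (marg {i} P y) else 0) +
            (if i = v then Real.log (marg {i} P y) else 0)) := by
        intro i; split_ifs <;> ring
      rw [Finset.sum_congr rfl fun i _ => this i, Finset.sum_sub_distrib, Finset.sum_add_distrib]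
      simp
    have hmp := fun T => marg_pos T hP0 y
    -- The ratio of the pair marginal to the two node marginals accounts for the edge `e` and for
    -- the drop by one in the degrees of `u` and `v`.
    have hlog := congrArg Real.log (hpair y)
    rw [Real.log_mul (hmp _).ne' (mul_pos (hα0 y) (hβ0 y)).ne',
      Real.log_mul (hα0 y).ne' (hβ0 y).ne',
      Real.log_mul (by positivity) (mul_pos (hmp _) (hmp _)).ne',
      Real.log_mul (hmp _).ne' (hmp _).ne', Real.log_mul hN0.ne' (Real.exp_pos _).ne',
      Real.log_exp] at hlog
    have hlogP : Real.log (P y) = κ + ∑ i, a i y + ∑ c ∈ E.erase e, b c y + b e y := by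
      rw [hP, Real.log_exp, ← Finset.add_sum_erase _ _ he]
      ring
    have hlogP' := hκ' y
    rw [hP'e, Real.log_exp, hc] at hlogP'
    simp only [hi, Finset.sum_add_distrib, Finset.sum_ite_eq', Finset.mem_univ, if_true] at hlogP'
    rw [hsum, ← Finset.add_sum_erase _ _ he, hlogP]
    linarith

end Forest

/-! ### First-order conditions at the output of a marginal oracle -/

section Oracle

variable {V : Type*} [Fintype V] [DecidableEq V]
  {X : V → Type*} [∀ i, Fintype (X i)] [∀ i, DecidableEq (X i)] [∀ i, Nonempty (X i)]
  {𝒞 : Finset (Finset V)}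

theorem gibbs_pos (θ : MargVec X 𝒞) (y : (i : V) → X i) : 0 < gibbs 𝒞 θ y :=
  div_pos (Real.exp_pos _) (Finset.sum_pos (fun _ _ => Real.exp_pos _) Finset.univ_nonempty)

theorem sum_gibbs (θ : MargVec X 𝒞) : ∑ y, gibbs 𝒞 θ y = 1 := by
  unfold gibbs
  rw [← Finset.sum_div]
  exact div_self (Finset.sum_pos (fun _ _ => Real.exp_pos _) Finset.univ_nonempty).ne'

theorem gibbsMarginals_mem (θ : MargVec X 𝒞) : gibbsMarginals 𝒞 θ ∈ marginalPolytope X 𝒞 :=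
  ⟨gibbs 𝒞 θ, ⟨fun y => (gibbs_pos θ y).le, sum_gibbs θ⟩, rfl⟩

theorem meanStat_inl_eq_marg (P : ((i : V) → X i) → ℝ) (i : V) (y : (i : V) → X i) :
    meanStat 𝒞 P (Sum.inl ⟨i, y i⟩) = marg {i} P y := by
  rw [meanStat_apply, marg]
  refine Finset.sum_congr rfl fun y' _ => ?_
  simp [suffStat_inl, agree, mul_comm]

theorem meanStat_inr_eq_marg (P : ((i : V) → X i) → ℝ) (c : {c : Finset V // c ∈ 𝒞})
    (y : (i : V) → X i) :
    meanStat 𝒞 P (Sum.inr ⟨c, fun i => y i.1⟩) = marg c.1 P y := by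
  rw [meanStat_apply, marg]
  refine Finset.sum_congr rfl fun y' _ => ?_
  rw [suffStat_inr, agree, mul_comm]
  congr 1
  refine if_congr ?_ rfl rfl
  simp [funext_iff]

theorem inner_suffStat (θ : MargVec X 𝒞) (y : (i : V) → X i) :
    ⟪θ, suffStat 𝒞 y⟫ = ∑ i, θ (Sum.inl ⟨i, y i⟩) +
      ∑ c : {c : Finset V // c ∈ 𝒞}, θ (Sum.inr ⟨c, fun i => y i.1⟩) := by
  rw [← sum_mul_suffStat, PiLp.inner_apply]
  exact Finset.sum_congr rfl fun k _ => by simp [mul_comm]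

/-- A vector whose inner product with all vertices is the same is orthogonal to the polytope. -/
theorem inner_sub_eq_zero_of_const {g : MargVec X 𝒞} {κ : ℝ}
    (hg : ∀ y, ⟪g, suffStat 𝒞 y⟫ = κ) {u w : MargVec X 𝒞} (hu : u ∈ marginalPolytope X 𝒞)
    (hw : w ∈ marginalPolytope X 𝒞) : ⟪g, u - w⟫ = 0 := by
  have key : ∀ u ∈ marginalPolytope X 𝒞, ⟪g, u⟫ = κ := by
    rintro _ ⟨P, hP, rfl⟩
    simp only [meanStat, inner_sum, inner_smul_right, hg, ← Finset.sum_mul, hP.2, one_mul]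
  rw [inner_sub_right, key u hu, key w hw, sub_self]

theorem exists_log_gibbs (hT : IsTreeStructured 𝒞) (θ : MargVec X 𝒞) :
    ∃ κ, ∀ y, Real.log (gibbs 𝒞 θ y) = κ + ∑ c ∈ 𝒞, Real.log (marg c (gibbs 𝒞 θ) y) +
      ∑ i, (1 - (cliqueDegree 𝒞 i : ℝ)) * Real.log (marg {i} (gibbs 𝒞 θ) y) := by
  refine exists_log_eq_sum_log_marg hT (sum_gibbs θ)
    (κ := -Real.log (∑ y', Real.exp ⟪θ, suffStat 𝒞 y'⟫))
    (a := fun i y => θ (Sum.inl ⟨i, y i⟩))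
    (b := fun c y => if h : c ∈ 𝒞 then θ (Sum.inr ⟨⟨c, h⟩, fun i => y i.1⟩) else 0) ?_ ?_ ?_
  · intro i y₁ y₂ h
    simp only [h i rfl]
  · intro c y₁ y₂ h
    have : (fun i : {i : V // i ∈ c} => y₁ i.1) = fun i : {i : V // i ∈ c} => y₂ i.1 :=
      funext fun i => h i.1 i.2
    simp only
    split_ifs
    · rw [this]
    · rfl
  · intro y
    have hZ : 0 < ∑ y', Real.exp ⟪θ, suffStat 𝒞 y'⟫ :=
      Finset.sum_pos (fun _ _ => Real.exp_pos _) Finset.univ_nonempty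
    rw [gibbs, add_assoc, Real.exp_add, Real.exp_neg, Real.exp_log hZ, inner_suffStat,
      div_eq_inv_mul, ← Finset.sum_coe_sort 𝒞]
    congr 4
    exact funext fun c => by rw [dif_pos c.2]

/-- Exact marginals of a forest-structured model are critical for the Bethe variational problem. -/
theorem inner_gibbsMarginals_eq_zero (hT : IsTreeStructured 𝒞) (θ : MargVec X 𝒞)
    {u w : MargVec X 𝒞} (hu : u ∈ marginalPolytope X 𝒞) (hw : w ∈ marginalPolytope X 𝒞) :
    ⟪-entropyGrad (gibbsMarginals 𝒞 θ) - θ, u - w⟫ = 0 := by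
  obtain ⟨κ, hκ⟩ := exists_log_gibbs hT θ
  have hZ : 0 < ∑ y', Real.exp ⟪θ, suffStat 𝒞 y'⟫ :=
    Finset.sum_pos (fun _ _ => Real.exp_pos _) Finset.univ_nonempty
  -- By the factorization, `⟨∇H_B, S(y)⟩` is `-log P(y)`, hence `-⟨θ, S(y)⟩`, up to a constant. The
  -- constant collects the normalizer and the `-1` in the derivative of `-x log x`, as each
  -- configuration selects one state per node and per clique.
  refine inner_sub_eq_zero_of_const (κ := -κ - Real.log (∑ y', Real.exp ⟪θ, suffStat 𝒞 y'⟫) +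
    (∑ i : V, (1 - (cliqueDegree 𝒞 i : ℝ)) + 𝒞.card)) (fun y => ?_) hu hw
  have h1 : Real.log (gibbs 𝒞 θ y) =
      ⟪θ, suffStat 𝒞 y⟫ - Real.log (∑ y', Real.exp ⟪θ, suffStat 𝒞 y'⟫) := by
    rw [gibbs, Real.log_div (Real.exp_pos _).ne' hZ.ne', Real.log_exp]
  have h2 : ⟪entropyGrad (gibbsMarginals 𝒞 θ), suffStat 𝒞 y⟫ =
      -(∑ i, (1 - (cliqueDegree 𝒞 i : ℝ)) * Real.log (marg {i} (gibbs 𝒞 θ) y)) -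
        ∑ i : V, (1 - (cliqueDegree 𝒞 i : ℝ)) -
        ∑ c ∈ 𝒞, Real.log (marg c (gibbs 𝒞 θ) y) - 𝒞.card := by
    rw [inner_suffStat]
    simp only [entropyGrad, coef, gibbsMarginals, meanStat_inl_eq_marg, meanStat_inr_eq_marg,
      mul_sub, mul_neg, mul_one, one_mul, Finset.sum_sub_distrib, Finset.sum_neg_distrib]
    rw [Finset.sum_coe_sort 𝒞 fun c => Real.log (marg c (gibbs 𝒞 θ) y)]
    simp
    ring
  have h3 := hκ y
  rw [inner_sub_left, inner_neg_left, h2]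
  linarith

theorem HasGradientAt.neg_betheEntropy {μ : MargVec X 𝒞} (hμ : ∀ k, 0 < μ k) :
    HasGradientAt (fun μ => -betheEntropy 𝒞 μ) (-entropyGrad μ) μ := by
  rw [hasGradientAt_iff_hasFDerivAt, map_neg]
  exact (hasGradientAt_betheEntropy hμ).hasFDerivAt.neg

theorem hasGradientAt_inner (θ μ : MargVec X 𝒞) : HasGradientAt (fun μ => ⟪θ, μ⟫) θ μ := by
  rw [hasGradientAt_iff_hasFDerivAt]
  exact (InnerProductSpace.toDual ℝ (MargVec X 𝒞) θ).hasFDerivAt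

theorem lipschitzWith_neg_inner (θ : MargVec X 𝒞) :
    LipschitzWith ‖θ‖₊ (fun μ : MargVec X 𝒞 => -⟪θ, μ⟫) := by
  refine LipschitzWith.of_dist_le_mul fun u w => ?_
  rw [Real.dist_eq, dist_eq_norm, coe_nnnorm, neg_sub_neg, ← inner_sub_right, norm_sub_rev]
  exact abs_real_inner_le_norm _ _

/-- The output of a marginal oracle lies in the polytope, has positive coordinates, and satisfies
the first-order optimality condition of the Bethe variational problem. -/
theorem oracle_spec {O : MargVec X 𝒞 → MargVec X 𝒞}
    (hO : IsBetheOracle 𝒞 O ∨ IsExactTreeOracle 𝒞 O) (θ : MargVec X 𝒞) :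
    O θ ∈ marginalPolytope X 𝒞 ∧ (∀ k, 0 < O θ k) ∧
      ∀ u ∈ marginalPolytope X 𝒞, 0 ≤ ⟪-entropyGrad (O θ) - θ, u - O θ⟫ := by
  rcases hO with hO | ⟨hT, hO⟩
  · obtain ⟨hmem, hmin⟩ := hO θ
    have hpos := pos_of_isMinOn (lipschitzWith_neg_inner θ).lipschitzOnWith hmem hmin
    refine ⟨hmem, hpos, fun u hu => ?_⟩
    have hg : HasGradientAt (baseObjective 𝒞 θ) (-entropyGrad (O θ) - θ) (O θ) := by
      rw [hasGradientAt_iff_hasFDerivAt, map_sub]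
      exact (HasGradientAt.neg_betheEntropy hpos).hasFDerivAt.sub
        (hasGradientAt_inner θ _).hasFDerivAt
    exact hmin.inner_gradient_nonneg convex_marginalPolytope hg hmem hu
  · rw [hO θ]
    exact ⟨gibbsMarginals_mem θ, meanStat_pos (gibbs_pos θ), fun u hu =>
      (inner_gibbsMarginals_eq_zero hT θ hu (gibbsMarginals_mem θ)).ge⟩

end Oracle

/-! ### The strong convexity constant of the negative Bethe entropy is at most two -/

section Curvature

open InformationTheory

/-- Second-order expansion of the logarithm at both points. It measures the curvature of the binary
entropy at its centre. -/
theorem mul_log_add_mul_log_le {δ : ℝ} (h0 : 0 < δ) (h1 : δ ≤ 1 / 2) :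
    (1 + δ) * Real.log (1 + δ) + (1 - δ) * Real.log (1 - δ) ≤ δ ^ 2 + 4 * δ ^ 3 := by
  have key : ∀ x : ℝ, |x| = δ → Real.log (1 - x) ≤ -x - x ^ 2 / 2 + 2 * δ ^ 3 := by
    intro x hx
    have h := Real.abs_log_sub_add_sum_range_le (x := x) (by rw [hx]; linarith) 2
    rw [hx] at h
    have h2 := (abs_le.1 h).2
    have h3 : δ ^ (2 + 1) / (1 - δ) ≤ 2 * δ ^ 3 := by
      rw [div_le_iff₀ (by linarith)]
      have := mul_nonneg (pow_pos h0 3).le (by linarith : (0 : ℝ) ≤ 1 - 2 * δ)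
      norm_num
      linarith
    norm_num [Finset.sum_range_succ] at h2 h3
    linarith
  have e1 := key (-δ) (by rw [abs_neg, abs_of_pos h0])
  have e2 := key δ (abs_of_pos h0)
  rw [sub_neg_eq_add] at e1
  have e3 := mul_le_mul_of_nonneg_left e1 (by linarith : (0 : ℝ) ≤ 1 + δ)
  have e4 := mul_le_mul_of_nonneg_left e2 (by linarith : (0 : ℝ) ≤ 1 - δ)
  nlinarith

theorem klFun_le_sq {r : ℝ} (hr : 0 ≤ r) : klFun r ≤ (r - 1) ^ 2 := by
  rw [klFun_apply]
  rcases hr.eq_or_lt with rfl | hr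
  · simp
  · nlinarith [mul_le_mul_of_nonneg_left (Real.log_le_sub_one_of_pos hr) hr.le]

/-- The derivative `log x + 1/x - 1` lies between 0 and `2 (x - 1)^2` for `x ≥ 1/2`, so the mean
value inequality gives a cubic bound. With `r = w/p`, the expression is the asymmetry of the two
Kullback-Leibler terms, up to the factor `-p`. -/
theorem abs_one_add_mul_log_sub_le {r : ℝ} (hr : 1 / 2 ≤ r) :
    |(1 + r) * Real.log r - 2 * (r - 1)| ≤ 2 * |r - 1| ^ 3 := by
  have hpos : ∀ x ∈ Set.uIcc 1 r, 1 / 2 ≤ x := by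
    intro x hx
    exact (le_min (by norm_num) hr).trans hx.1
  have hd : ∀ x ∈ Set.uIcc 1 r, HasDerivWithinAt
      (fun x => (1 + x) * Real.log x - 2 * (x - 1)) (Real.log x + x⁻¹ - 1) (Set.uIcc 1 r) x := by
    intro x hx
    have hx0 : x ≠ 0 := by linarith [hpos x hx]
    have h1 := ((hasDerivAt_id x).const_add 1).mul (Real.hasDerivAt_log hx0)
    have h2 := (((hasDerivAt_id x).sub_const 1).const_mul 2)
    refine ((h1.sub h2).congr_deriv ?_).hasDerivWithinAt
    simp only [id]
    field_simp
    ring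
  have hb : ∀ x ∈ Set.uIcc 1 r, ‖Real.log x + x⁻¹ - 1‖ ≤ 2 * (r - 1) ^ 2 := by
    intro x hx
    have hx2 := hpos x hx
    have hx0 : 0 < x := by linarith
    have h1 := Real.log_le_sub_one_of_pos hx0
    have h2 := Real.one_sub_inv_le_log_of_pos hx0
    have h3 : (x - 1) ^ 2 ≤ (r - 1) ^ 2 := by
      rw [sq_le_sq]
      exact Set.abs_sub_left_of_mem_uIcc hx
    have h4 : x + x⁻¹ - 2 ≤ 2 * (x - 1) ^ 2 := by
      have : x + x⁻¹ - 2 = (x - 1) ^ 2 * x⁻¹ := by field_simp; ring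
      rw [this, mul_comm 2]
      refine mul_le_mul_of_nonneg_left ?_ (sq_nonneg _)
      rw [inv_le_comm₀ hx0 two_pos]
      linarith
    rw [Real.norm_eq_abs, abs_of_nonneg (by linarith)]
    linarith
  have h := (convex_uIcc (1 : ℝ) r).norm_image_sub_le_of_norm_hasDerivWithin_le hd hb
    Set.left_mem_uIcc Set.right_mem_uIcc
  have h2 : |r - 1| ^ 3 = (r - 1) ^ 2 * |r - 1| := by rw [← sq_abs]; ring
  rw [h2]
  simpa [mul_assoc] using h

variable {V : Type*} [Fintype V] [DecidableEq V]
  {X : V → Type*} [∀ i, Fintype (X i)] [∀ i, DecidableEq (X i)] {𝒞 : Finset (Finset V)}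

/-- The same cancellation `(1 - d_i) + d_i = 1` as for boundary slopes: the two configurations
differ exactly at node `i` and at the cliques containing it. -/
theorem sum_coef_mul_of_agree_off {i : V} {y y' : (i : V) → X i} (hi : y i ≠ y' i)
    (hoff : ∀ j, j ≠ i → y j = y' j) :
    ∑ k, coef 𝒞 k * (1 - suffStat 𝒞 y' k) * suffStat 𝒞 y k = 1 := by
  rw [sum_mul_suffStat]
  have h1 : ∀ j, coef 𝒞 (Sum.inl ⟨j, y j⟩) * (1 - suffStat 𝒞 y' (Sum.inl ⟨j, y j⟩)) =
      if j = i then 1 - (cliqueDegree 𝒞 i : ℝ) else 0 := by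
    intro j
    rw [suffStat_inl]
    by_cases hj : j = i
    · subst hj
      simp [coef, hi.symm]
    · simp [hj, hoff j hj]
  have h2 : ∀ c : {c : Finset V // c ∈ 𝒞}, coef 𝒞 (Sum.inr ⟨c, fun j => y j.1⟩) *
      (1 - suffStat 𝒞 y' (Sum.inr ⟨c, fun j => y j.1⟩)) = if i ∈ c.1 then 1 else 0 := by
    intro c
    rw [suffStat_inr]
    by_cases hc : i ∈ c.1
    · rw [if_pos hc, if_neg fun h => hi (congrFun h ⟨i, hc⟩).symm]
      simp [coef]
    · rw [if_neg hc, if_pos]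
      · simp
      · ext j
        refine (hoff _ ?_).symm
        rintro rfl
        exact hc j.2
  rw [Finset.sum_congr rfl fun j _ => h1 j, Finset.sum_congr rfl fun c _ => h2 c,
    ← cliqueDegree_eq_sum]
  simp

/-- Along an edge of the polytope on which only one node changes its state, the Bethe entropy is the
binary entropy. -/
theorem betheEntropy_segment {i : V} {y y' : (i : V) → X i} (hi : y i ≠ y' i)
    (hoff : ∀ j, j ≠ i → y j = y' j) (s t : ℝ) (hst : s + t = 1) :
    betheEntropy 𝒞 (s • suffStat 𝒞 y + t • suffStat 𝒞 y') =
      Real.negMulLog s + Real.negMulLog t := by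
  rw [betheEntropy_eq_sum]
  have h : ∀ k, coef 𝒞 k * Real.negMulLog ((s • suffStat 𝒞 y + t • suffStat 𝒞 y') k) =
      Real.negMulLog s * (coef 𝒞 k * (1 - suffStat 𝒞 y' k) * suffStat 𝒞 y k) +
      Real.negMulLog t * (coef 𝒞 k * (1 - suffStat 𝒞 y k) * suffStat 𝒞 y' k) := by
    intro k
    simp only [PiLp.add_apply, PiLp.smul_apply, smul_eq_mul]
    rcases suffStat_eq_zero_or_one y k with h1 | h1 <;>
      rcases suffStat_eq_zero_or_one y' k with h2 | h2 <;> simp [h1, h2, hst] <;> ring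
  rw [Finset.sum_congr rfl fun k _ => h k, Finset.sum_add_distrib, ← Finset.mul_sum,
    ← Finset.mul_sum, sum_coef_mul_of_agree_off hi hoff,
    sum_coef_mul_of_agree_off hi.symm fun j hj => (hoff j hj).symm]
  ring

theorem two_le_norm_sub_sq {i : V} {y y' : (i : V) → X i} (hi : y i ≠ y' i) :
    2 ≤ ‖suffStat 𝒞 y - suffStat 𝒞 y'‖ ^ 2 := by
  rw [EuclideanSpace.norm_sq_eq]
  have hne : (Sum.inl ⟨i, y i⟩ : Index X 𝒞) ≠ Sum.inl ⟨i, y' i⟩ := by simpa using hi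
  have := Finset.add_le_sum (s := Finset.univ)
    (f := fun k => ‖(suffStat 𝒞 y - suffStat 𝒞 y') k‖ ^ 2) (fun _ _ => sq_nonneg _)
    (Finset.mem_univ (Sum.inl ⟨i, y i⟩ : Index X 𝒞)) (Finset.mem_univ (Sum.inl ⟨i, y' i⟩)) hne
  refine le_trans ?_ this
  simp [suffStat_inl, hi, hi.symm]
  norm_num

/-- On an edge of the polytope where one node flips, `-H_B` is the negative binary entropy, whose
second derivative at the midpoint is 4, while the edge has squared length at least 2. -/
theorem strongConvexity_le_two [∀ i, Nonempty (X i)] {lam : ℝ}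
    (hH : StrongConvexOn (marginalPolytope X 𝒞) lam (fun μ => -betheEntropy 𝒞 μ))
    {i : V} (hi : Nontrivial (X i)) : lam ≤ 2 := by
  obtain ⟨x, x', hx⟩ := exists_pair_ne (X i)
  set y := Function.update (fun _ => Classical.arbitrary _ : (i : V) → X i) i x
  set y' := Function.update (fun _ => Classical.arbitrary _ : (i : V) → X i) i x'
  have hyi : y i ≠ y' i := by simpa [y, y'] using hx
  have hoff : ∀ j, j ≠ i → y j = y' j := fun j hj => by simp [y, y', hj]
  by_contra! hlam
  have key : ∀ δ : ℝ, 0 < δ → δ ≤ 1 / 2 → lam ≤ 2 + 8 * δ := by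
    intro δ h0 h1
    have hM := convex_marginalPolytope (X := X) (𝒞 := 𝒞)
    have hmem : ∀ s t : ℝ, 0 ≤ s → 0 ≤ t → s + t = 1 →
        s • suffStat 𝒞 y + t • suffStat 𝒞 y' ∈ marginalPolytope X 𝒞 := fun s t hs ht hst =>
      hM (suffStat_mem y) (suffStat_mem y') hs ht hst
    have h := hH.2 (hmem ((1 + δ) / 2) ((1 - δ) / 2) (by linarith) (by linarith) (by ring))
      (hmem ((1 - δ) / 2) ((1 + δ) / 2) (by linarith) (by linarith) (by ring))
      (by norm_num : (0 : ℝ) ≤ 1 / 2) (by norm_num : (0 : ℝ) ≤ 1 / 2) (by norm_num)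
    have e1 : (1 / 2 : ℝ) • (((1 + δ) / 2) • suffStat 𝒞 y + ((1 - δ) / 2) • suffStat 𝒞 y') +
        (1 / 2 : ℝ) • (((1 - δ) / 2) • suffStat 𝒞 y + ((1 + δ) / 2) • suffStat 𝒞 y') =
        (1 / 2 : ℝ) • suffStat 𝒞 y + (1 / 2 : ℝ) • suffStat 𝒞 y' := by module
    have e2 : (((1 + δ) / 2) • suffStat 𝒞 y + ((1 - δ) / 2) • suffStat 𝒞 y') -
        (((1 - δ) / 2) • suffStat 𝒞 y + ((1 + δ) / 2) • suffStat 𝒞 y') =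
        δ • (suffStat 𝒞 y - suffStat 𝒞 y') := by module
    rw [e1, e2, norm_smul, Real.norm_of_nonneg h0.le] at h
    simp only [smul_eq_mul, mul_pow] at h
    rw [betheEntropy_segment hyi hoff _ _ (by ring), betheEntropy_segment hyi hoff _ _ (by ring),
      betheEntropy_segment hyi hoff _ _ (by ring)] at h
    have l1 : Real.negMulLog ((1 + δ) / 2) =
        -((1 + δ) / 2) * (Real.log (1 + δ) - Real.log 2) := by
      rw [Real.negMulLog, Real.log_div (by linarith) two_ne_zero]
    have l2 : Real.negMulLog ((1 - δ) / 2) =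
        -((1 - δ) / 2) * (Real.log (1 - δ) - Real.log 2) := by
      rw [Real.negMulLog, Real.log_div (by linarith) two_ne_zero]
    have l3 : Real.negMulLog (1 / 2) = (1 / 2) * Real.log 2 := by
      rw [Real.negMulLog, one_div, Real.log_inv]; ring
    rw [l1, l2, l3] at h
    have hn := two_le_norm_sub_sq (𝒞 := 𝒞) hyi
    have hb := mul_log_add_mul_log_le h0 h1
    have hn' : lam * δ ^ 2 * 2 ≤ lam * δ ^ 2 * ‖suffStat 𝒞 y - suffStat 𝒞 y'‖ ^ 2 :=
      mul_le_mul_of_nonneg_left hn (by positivity)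
    have h3 : lam * δ ^ 2 ≤ (2 + 8 * δ) * δ ^ 2 := by nlinarith
    exact le_of_mul_le_mul_right h3 (by positivity)
  -- With this `δ`, the bound `2 + 8δ` is at most the midpoint of 2 and `lam`.
  have := key (min (1 / 2) ((lam - 2) / 16)) (lt_min (by norm_num) (by linarith)) (min_le_left _ _)
  have h2 := min_le_right (1 / 2) ((lam - 2) / 16)
  linarith

/-! ### Local comparison of the two Bregman divergences -/

theorem abs_coord_le_norm (v : MargVec X 𝒞) (k : Index X 𝒞) : |v k| ≤ ‖v‖ :=
  PiLp.norm_apply_le v k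

/-- Each term satisfies `klFun r ≤ (r - 1)^2`, and positivity of `p` keeps the denominators away
from 0. The signs of the coefficients are discarded. -/
theorem exists_bregman_le_mul_sq {p : MargVec X 𝒞} (hp : ∀ k, 0 < p k) :
    ∃ C, 0 ≤ C ∧ ∀ w : MargVec X 𝒞, (∀ k, 0 ≤ w k) → bregman w p ≤ C * ‖w - p‖ ^ 2 := by
  refine ⟨∑ k, |coef 𝒞 k| / p k, Finset.sum_nonneg fun k _ => div_nonneg (abs_nonneg _) (hp k).le,
    fun w hw => ?_⟩
  rw [bregman_eq_sum hp, Finset.sum_mul]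
  refine Finset.sum_le_sum fun k _ => ?_
  have h0 : 0 ≤ p k * klFun (w k / p k) :=
    mul_nonneg (hp k).le (klFun_nonneg (div_nonneg (hw k) (hp k).le))
  have h1 : p k * klFun (w k / p k) ≤ (w k - p k) ^ 2 / p k := by
    refine (mul_le_mul_of_nonneg_left (klFun_le_sq (div_nonneg (hw k) (hp k).le)) (hp k).le).trans
      (le_of_eq ?_)
    have := (hp k).ne'
    field_simp
  have h2 : (w k - p k) ^ 2 ≤ ‖w - p‖ ^ 2 := by
    rw [← sq_abs]
    exact pow_le_pow_left₀ (abs_nonneg _) (abs_coord_le_norm (w - p) k) 2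
  calc coef 𝒞 k * (p k * klFun (w k / p k)) ≤ |coef 𝒞 k| * (p k * klFun (w k / p k)) :=
        mul_le_mul_of_nonneg_right (le_abs_self _) h0
    _ ≤ |coef 𝒞 k| * (‖w - p‖ ^ 2 / p k) :=
        mul_le_mul_of_nonneg_left (h1.trans (div_le_div_of_nonneg_right h2 (hp k).le))
          (abs_nonneg _)
    _ = |coef 𝒞 k| / p k * ‖w - p‖ ^ 2 := by ring

/-- Up to a cubic error, the Bregman divergence is symmetric near a positive point. -/
theorem exists_bregman_sub_le_cube {p : MargVec X 𝒞} (hp : ∀ k, 0 < p k) :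
    ∃ ρ C, 0 < ρ ∧ 0 ≤ C ∧ ∀ w : MargVec X 𝒞, (∀ k, 0 < w k) → ‖w - p‖ ≤ ρ →
      bregman p w - bregman w p ≤ C * ‖w - p‖ ^ 3 := by
  -- Half the smallest coordinate of `p`: within this radius all ratios `w k / p k` are at least
  -- 1/2.
  obtain ⟨ρ, hρ0, hρ⟩ : ∃ ρ : ℝ, 0 < ρ ∧ ∀ k, ρ ≤ p k / 2 := by
    rcases isEmpty_or_nonempty (Index X 𝒞) with h | h
    · exact ⟨1, one_pos, fun k => isEmptyElim k⟩
    · obtain ⟨k, hk⟩ := Finite.exists_min fun k => p k / 2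
      exact ⟨p k / 2, half_pos (hp k), hk⟩
  refine ⟨ρ, ∑ k, |coef 𝒞 k| * (2 / p k ^ 2), hρ0, Finset.sum_nonneg fun k _ =>
    mul_nonneg (abs_nonneg _) (by positivity), fun w hw hwp => ?_⟩
  rw [bregman_eq_sum hp, bregman_eq_sum hw, Finset.sum_mul, ← Finset.sum_sub_distrib]
  refine Finset.sum_le_sum fun k _ => ?_
  have hpk := hp k
  have hwk := hw k
  have hab : |w k - p k| ≤ ‖w - p‖ := abs_coord_le_norm (w - p) k
  have hr : 1 / 2 ≤ w k / p k := by
    rw [le_div_iff₀ hpk]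
    have := (abs_le.1 (hab.trans (hwp.trans (hρ k)))).1
    linarith
  have hcub := abs_one_add_mul_log_sub_le hr
  have e1 : w k * klFun (p k / w k) - p k * klFun (w k / p k) =
      -(p k * ((1 + w k / p k) * Real.log (w k / p k) - 2 * (w k / p k - 1))) := by
    rw [klFun_apply, klFun_apply, Real.log_div hpk.ne' hwk.ne', Real.log_div hwk.ne' hpk.ne']
    field_simp
    ring
  have e2 : |w k / p k - 1| = |w k - p k| / p k := by
    rw [← abs_of_pos hpk, ← abs_div, abs_of_pos hpk, sub_div, div_self hpk.ne']
  rw [← mul_sub, e1]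
  calc coef 𝒞 k * -(p k * ((1 + w k / p k) * Real.log (w k / p k) - 2 * (w k / p k - 1)))
      ≤ |coef 𝒞 k| * (p k * |(1 + w k / p k) * Real.log (w k / p k) - 2 * (w k / p k - 1)|) := by
        refine (le_abs_self _).trans (le_of_eq ?_)
        rw [abs_mul, abs_neg, abs_mul, abs_of_pos hpk]
    _ ≤ |coef 𝒞 k| * (p k * (2 * (|w k - p k| / p k) ^ 3)) := by
        rw [e2] at hcub
        gcongr
    _ ≤ |coef 𝒞 k| * (p k * (2 * (‖w - p‖ / p k) ^ 3)) := by gcongr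
    _ = |coef 𝒞 k| * (2 / p k ^ 2) * ‖w - p‖ ^ 3 := by field_simp

end Curvature

/-! ### Rates from a one-step recursion -/

section Rates

theorem sum_Icc_inv_le (t : ℕ) : ∑ s ∈ Finset.Icc 1 t, ((s : ℝ))⁻¹ ≤ 1 + Real.log t := by
  have := harmonic_le_one_add_log t
  rw [harmonic_eq_sum_Icc] at this
  push_cast at this
  exact this

theorem sum_Icc_inv_sqrt_le (t : ℕ) : ∑ s ∈ Finset.Icc 1 t, (√(s : ℝ))⁻¹ ≤ 2 * √(t : ℝ) := by
  induction t with
  | zero => simp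
  | succ n ih =>
    rw [Finset.sum_Icc_succ_top (by omega)]
    have h0 : (0 : ℝ) < √((n + 1 : ℕ) : ℝ) := Real.sqrt_pos.2 (by positivity)
    have h1 : √((n + 1 : ℕ) : ℝ) ^ 2 = n + 1 := by rw [Real.sq_sqrt (by positivity)]; push_cast; rfl
    have h2 : √(n : ℝ) ^ 2 = n := Real.sq_sqrt (by positivity)
    have h3 : (√((n + 1 : ℕ) : ℝ))⁻¹ ≤ 2 * √((n + 1 : ℕ) : ℝ) - 2 * √(n : ℝ) := by
      rw [inv_le_iff_one_le_mul₀ h0]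
      nlinarith [sq_nonneg (√((n + 1 : ℕ) : ℝ) - √(n : ℝ))]
    linarith

theorem sum_Icc_rpow_neg_three_quarters_le (t : ℕ) :
    ∑ s ∈ Finset.Icc 1 t, (s : ℝ) ^ (-(3 / 4) : ℝ) ≤ 4 * (t : ℝ) ^ (1 / 4 : ℝ) := by
  induction t with
  | zero => simp
  | succ n ih =>
    rw [Finset.sum_Icc_succ_top (by omega)]
    set m : ℝ := ((n + 1 : ℕ) : ℝ) with hm
    have hm0 : 0 < m := by positivity
    have hn : (n : ℝ) = m * (1 + -m⁻¹) := by
      rw [mul_add, mul_neg, mul_inv_cancel₀ hm0.ne', hm]; push_cast; ring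
    have hm1 : m⁻¹ ≤ 1 := inv_le_one_of_one_le₀ (by
      rw [hm]; push_cast; linarith [n.cast_nonneg (α := ℝ)])
    -- Bernoulli's inequality for the exponent 1/4 bounds the increment of `4 m^(1/4)` from below by
    -- `m^(-3/4)`.
    have hb := rpow_one_add_le_one_add_mul_self (s := -m⁻¹) (by linarith)
      (p := 1 / 4) (by norm_num) (by norm_num)
    have h1 : (n : ℝ) ^ (1 / 4 : ℝ) ≤ m ^ (1 / 4 : ℝ) * (1 + 1 / 4 * -m⁻¹) := by
      rw [hn, Real.mul_rpow hm0.le (by linarith)]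
      exact mul_le_mul_of_nonneg_left hb (by positivity)
    have h2 : m ^ (-(3 / 4) : ℝ) = m ^ (1 / 4 : ℝ) * m⁻¹ := by
      rw [← Real.rpow_neg_one m, ← Real.rpow_add hm0]; norm_num
    rw [h2]
    linarith

theorem rpow_three_halves_le {x E s a : ℝ} (hx : 0 ≤ x) (hE : 0 ≤ E) (hs : 0 ≤ s)
    (h : x ≤ E * s ^ a) : x ^ (3 / 2 : ℝ) ≤ E ^ (3 / 2 : ℝ) * s ^ (a * (3 / 2)) := by
  rw [Real.rpow_mul hs, ← Real.mul_rpow hE (Real.rpow_nonneg hs _)]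
  exact Real.rpow_le_rpow hx h (by norm_num)

theorem le_add_sum_Icc {y r : ℕ → ℝ} (h : ∀ t, y (t + 1) ≤ y t + r (t + 1)) (t : ℕ) :
    y t ≤ y 0 + ∑ s ∈ Finset.Icc 1 t, r s := by
  induction t with
  | zero => simp
  | succ n ih =>
    rw [Finset.sum_Icc_succ_top (by omega)]
    linarith [h n]

variable {lam C c : ℝ} {d d' G : ℕ → ℝ}

/-- A first, crude decay estimate. -/
theorem exists_le_rpow_neg_half (hlam : 0 < lam) (hlam2 : lam ≤ 2) (hc : 0 ≤ c)
    (hd : ∀ t, 0 ≤ d t) (hrec : ∀ t : ℕ,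
      (lam * (t + 1) + 1) * d (t + 1) ≤ lam * (t + 1) * d t + c / (t + 1)) :
    ∃ E, 0 ≤ E ∧ ∀ t : ℕ, 1 ≤ t → d t ≤ E * (t : ℝ) ^ (-(1 / 2) : ℝ) := by
  have hstep : ∀ t : ℕ, √((t : ℝ) + 1 + 1) * d (t + 1) ≤
      √((t : ℝ) + 1) * d t + c / lam * ((t : ℝ) + 1) ^ (-(3 / 2) : ℝ) := by
    intro t
    set s : ℝ := (t : ℝ) + 1 with hs
    have hs0 : 0 < s := by positivity
    -- Only `1/lam ≥ 1/2` is used here, giving the contraction `s / (s + 1/2) ≤ √s / √(s + 1)`.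
    -- Hence `√(t + 1) * d t` grows by at most a summable amount.
    have h1 : (s + 1 / 2) * d (t + 1) ≤ s * (d t + c / lam * (s ^ 2)⁻¹) := by
      have h2 : 1 / 2 * d (t + 1) ≤ 1 / lam * d (t + 1) :=
        mul_le_mul_of_nonneg_right (one_div_le_one_div_of_le hlam hlam2) (hd _)
      have h3 : (s + 1 / lam) * d (t + 1) ≤ s * (d t + c / lam * (s ^ 2)⁻¹) := by
        have := div_le_div_of_nonneg_right (hrec t) hlam.le
        rw [← hs] at this
        refine le_of_eq_of_le ?_ (this.trans_eq ?_)
        · field_simp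
        · field_simp
      linarith
    have h4 : √(s + 1) * s ≤ √s * (s + 1 / 2) := by
      refine abs_le_of_sq_le_sq' ?_ (by positivity) |>.2
      rw [mul_pow, mul_pow, Real.sq_sqrt (by positivity), Real.sq_sqrt hs0.le]
      nlinarith
    have h5 : √(s + 1) * d (t + 1) ≤ √s * (d t + c / lam * (s ^ 2)⁻¹) := by
      have hpos : 0 < s + 1 / 2 := by positivity
      refine le_of_mul_le_mul_right ?_ hpos
      calc √(s + 1) * d (t + 1) * (s + 1 / 2) = √(s + 1) * ((s + 1 / 2) * d (t + 1)) := by ring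
        _ ≤ √(s + 1) * (s * (d t + c / lam * (s ^ 2)⁻¹)) := by gcongr
        _ = (√(s + 1) * s) * (d t + c / lam * (s ^ 2)⁻¹) := by ring
        _ ≤ (√s * (s + 1 / 2)) * (d t + c / lam * (s ^ 2)⁻¹) := by
          have := hd t
          gcongr
        _ = _ := by ring
    have h6 : √s * (s ^ 2)⁻¹ = s ^ (-(3 / 2) : ℝ) := by
      rw [Real.sqrt_eq_rpow, ← Real.rpow_natCast, ← Real.rpow_neg hs0.le, ← Real.rpow_add hs0]
      norm_num
    rw [← h6]
    linarith
  have hsum : Summable fun n : ℕ => (n : ℝ) ^ (-(3 / 2) : ℝ) :=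
    Real.summable_nat_rpow.2 (by norm_num)
  have hbd := le_add_sum_Icc (y := fun t => √((t : ℝ) + 1) * d t)
    (r := fun t => c / lam * (t : ℝ) ^ (-(3 / 2) : ℝ)) (fun t => by simpa using hstep t)
  refine ⟨d 0 + c / lam * ∑' n : ℕ, (n : ℝ) ^ (-(3 / 2) : ℝ), ?_, fun t ht => ?_⟩
  · have : 0 ≤ ∑' n : ℕ, (n : ℝ) ^ (-(3 / 2) : ℝ) := tsum_nonneg fun n => by positivity
    have := hd 0
    positivity
  · have ht0 : (0 : ℝ) < t := by exact_mod_cast ht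
    have h1 := hbd t
    simp only [Nat.cast_zero, zero_add, Real.sqrt_one, one_mul, ← Finset.mul_sum] at h1
    have h2 : ∑ s ∈ Finset.Icc 1 t, (s : ℝ) ^ (-(3 / 2) : ℝ) ≤
        ∑' n : ℕ, (n : ℝ) ^ (-(3 / 2) : ℝ) :=
      hsum.sum_le_tsum _ fun n _ => by positivity
    have h3 : √(t : ℝ) * d t ≤ √((t : ℝ) + 1) * d t :=
      mul_le_mul_of_nonneg_right (Real.sqrt_le_sqrt (by linarith)) (hd t)
    have h4 := mul_le_mul_of_nonneg_left h2 (div_nonneg hc hlam.le)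
    rw [Real.rpow_neg ht0.le, ← Real.sqrt_eq_rpow, ← div_eq_mul_inv,
      le_div_iff₀ (Real.sqrt_pos.2 ht0)]
    linarith

/-- The rates of the divergence to the solution and of the sum of the remaining optimality gaps. -/
theorem exists_rates (hlam : 0 < lam) (hlam2 : lam ≤ 2) (hc : 0 ≤ c) (hC : 0 ≤ C)
    (hd : ∀ t, 0 ≤ d t) (hd' : ∀ t, 0 ≤ d' t) (hG : ∀ t, 0 ≤ G t)
    (hcmp : ∀ t, d t - d' t ≤ C * d t ^ (3 / 2 : ℝ))
    (hrec : ∀ t : ℕ, G (t + 1) + d' (t + 1) + (lam * (t + 1) + 1) * d (t + 1) ≤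
      lam * (t + 1) * d t + c / (t + 1)) :
    ∃ B, 0 ≤ B ∧ ∀ t : ℕ, 1 ≤ t → d t ≤ B * (1 + Real.log t) / t ∧
      ∑ s ∈ Finset.Icc 1 t, G s ≤ B * (1 + Real.log t) := by
  obtain ⟨E, hE, hdE⟩ := exists_le_rpow_neg_half hlam hlam2 hc hd
    (fun t => by linarith [hrec t, hG (t + 1), hd' (t + 1)])
  -- Replacing `d'` by `d` up to the error raises the left coefficient to `lam (t + 1) + 2 ≥ lam (t
  -- + 2)`, so `(t + 1) * d t` telescopes.
  have hy : ∀ t : ℕ, ((t + 1 : ℕ) + 1 : ℝ) * d (t + 1) ≤ ((t : ℝ) + 1) * d t +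
      (c * ((t + 1 : ℕ) : ℝ)⁻¹ + C * d (t + 1) ^ (3 / 2 : ℝ)) / lam := by
    intro t
    have h1 : (lam * (t + 1) + 2) * d (t + 1) ≤ lam * ((t + 1) * d t) +
        (c * ((t + 1 : ℕ) : ℝ)⁻¹ + C * d (t + 1) ^ (3 / 2 : ℝ)) := by
      have := hrec t
      have h2 := hcmp (t + 1)
      have h3 := hG (t + 1)
      push_cast
      rw [div_eq_mul_inv] at this
      linarith
    have h2 : lam * (((t + 1 : ℕ) + 1 : ℝ) * d (t + 1)) ≤ (lam * (t + 1) + 2) * d (t + 1) := by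
      push_cast
      have := mul_le_mul_of_nonneg_right hlam2 (hd (t + 1))
      linarith
    refine le_of_mul_le_mul_left ?_ hlam
    refine (h2.trans h1).trans_eq ?_
    field_simp
  have hysum := le_add_sum_Icc (y := fun t => ((t : ℝ) + 1) * d t)
    (r := fun t => (c * (t : ℝ)⁻¹ + C * d t ^ (3 / 2 : ℝ)) / lam) hy
  simp only [Nat.cast_zero, zero_add, one_mul] at hysum
  have hmul : ∀ t : ℕ, (t : ℝ) * d t ≤ ((t : ℝ) + 1) * d t := fun t =>
    mul_le_mul_of_nonneg_right (by linarith) (hd t)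
  set K₁ := (c + C * E ^ (3 / 2 : ℝ)) / lam with hK₁
  have hK₁0 : 0 ≤ K₁ := by positivity
  -- First bootstrap: the crude rate makes the error `t^(-3/4)`, whose sum is of order `t^(1/4)`;
  -- then divide by `t`.
  have hd34 : ∀ t : ℕ, 1 ≤ t → d t ≤ (d 0 + 4 * K₁) * (t : ℝ) ^ (-(3 / 4) : ℝ) := by
    intro t ht
    have ht1 : (1 : ℝ) ≤ t := by exact_mod_cast ht
    have ht0 : (0 : ℝ) < t := by linarith
    have h1 : ∑ s ∈ Finset.Icc 1 t, (c * (s : ℝ)⁻¹ + C * d s ^ (3 / 2 : ℝ)) / lam ≤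
        ∑ s ∈ Finset.Icc 1 t, K₁ * (s : ℝ) ^ (-(3 / 4) : ℝ) := by
      refine Finset.sum_le_sum fun s hs => ?_
      have hs1 : (1 : ℝ) ≤ s := by exact_mod_cast (Finset.mem_Icc.1 hs).1
      have h2 : (s : ℝ)⁻¹ ≤ (s : ℝ) ^ (-(3 / 4) : ℝ) := by
        rw [← Real.rpow_neg_one]
        exact Real.rpow_le_rpow_of_exponent_le hs1 (by norm_num)
      have h3 := rpow_three_halves_le (hd s) hE (by linarith) (hdE s (Finset.mem_Icc.1 hs).1)
      have h4 : (-(1 / 2) * (3 / 2) : ℝ) = -(3 / 4) := by norm_num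
      rw [h4] at h3
      rw [hK₁, div_mul_eq_mul_div, add_mul, mul_assoc C]
      gcongr
    rw [← Finset.mul_sum] at h1
    have h2 := mul_le_mul_of_nonneg_left (sum_Icc_rpow_neg_three_quarters_le t) hK₁0
    have h3 : 1 ≤ (t : ℝ) ^ (1 / 4 : ℝ) := Real.one_le_rpow ht1 (by norm_num)
    have h4 : (t : ℝ) * d t ≤ (d 0 + 4 * K₁) * (t : ℝ) ^ (1 / 4 : ℝ) := by
      have := mul_le_mul_of_nonneg_left h3 (hd 0)
      linarith [hysum t, hmul t]
    have h5 : (t : ℝ) ^ (-(3 / 4) : ℝ) = (t : ℝ) ^ (1 / 4 : ℝ) / t := by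
      rw [← Real.rpow_sub_one ht0.ne']; norm_num
    rw [h5, ← mul_div_assoc, le_div_iff₀ ht0]
    linarith
  set K₂ := (d 0 + 4 * K₁) ^ (3 / 2 : ℝ) with hK₂
  have hbase : 0 ≤ d 0 + 4 * K₁ := by linarith [hd 0]
  have hK₂0 : 0 ≤ K₂ := by positivity
  -- Second bootstrap: the exponent is now `-9/8`, so the error is dominated by `1/t` and adds only
  -- another harmonic sum.
  have hd32 : ∀ t : ℕ, 1 ≤ t → d t ^ (3 / 2 : ℝ) ≤ K₂ * (t : ℝ)⁻¹ := by
    intro t ht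
    have ht1 : (1 : ℝ) ≤ t := by exact_mod_cast ht
    refine (rpow_three_halves_le (hd t) hbase (by linarith) (hd34 t ht)).trans ?_
    refine mul_le_mul_of_nonneg_left ?_ hK₂0
    rw [← Real.rpow_neg_one]
    exact Real.rpow_le_rpow_of_exponent_le ht1 (by norm_num)
  set K₃ := c + C * K₂ with hK₃
  have hK₃0 : 0 ≤ K₃ := by positivity
  have hlogle : ∀ t : ℕ, 1 ≤ t → (1 : ℝ) ≤ 1 + Real.log t := fun t ht => by
    have := Real.log_nonneg (x := t) (by exact_mod_cast ht)
    linarith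
  refine ⟨(d 0 + K₃ / lam) + (lam * d 0 + K₃), by have := hd 0; positivity, fun t ht => ?_⟩
  have ht0 : (0 : ℝ) < t := by exact_mod_cast ht
  have hl := hlogle t ht
  have hinv := sum_Icc_inv_le t
  have hd0l := mul_le_mul_of_nonneg_left hl (hd 0)
  have hB : 0 ≤ lam * d 0 * (1 + Real.log t) := mul_nonneg (mul_nonneg hlam.le (hd 0)) (by linarith)
  constructor
  · have h1 : ∑ s ∈ Finset.Icc 1 t, (c * (s : ℝ)⁻¹ + C * d s ^ (3 / 2 : ℝ)) / lam ≤
        ∑ s ∈ Finset.Icc 1 t, K₃ / lam * (s : ℝ)⁻¹ := by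
      refine Finset.sum_le_sum fun s hs => ?_
      have h3 := hd32 s (Finset.mem_Icc.1 hs).1
      rw [hK₃, div_mul_eq_mul_div, add_mul, mul_assoc C]
      gcongr
    rw [← Finset.mul_sum] at h1
    have h2 := mul_le_mul_of_nonneg_left hinv (div_nonneg hK₃0 hlam.le)
    have h3 := mul_nonneg hK₃0 (by linarith : 0 ≤ 1 + Real.log t)
    rw [le_div_iff₀ ht0]
    linarith [hysum t, hmul t]
  · have hstep : ∀ t : ℕ, (∑ s ∈ Finset.Icc 1 (t + 1), G s) + lam * ((t + 1 : ℕ) + 1) * d (t + 1) ≤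
        (∑ s ∈ Finset.Icc 1 t, G s) + lam * (t + 1) * d t + K₃ * ((t + 1 : ℕ) : ℝ)⁻¹ := by
      intro t
      rw [Finset.sum_Icc_succ_top (by omega)]
      have h1 := hrec t
      have h2 := hcmp (t + 1)
      have h3 := mul_le_mul_of_nonneg_left (hd32 (t + 1) (by omega)) hC
      have h4 := mul_le_mul_of_nonneg_right hlam2 (hd (t + 1))
      rw [div_eq_mul_inv] at h1
      push_cast at h3 ⊢
      rw [hK₃]
      linarith
    have h1 := le_add_sum_Icc (y := fun t => (∑ s ∈ Finset.Icc 1 t, G s) + lam * (t + 1) * d t)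
      (r := fun t => K₃ * (t : ℝ)⁻¹) hstep t
    rw [← Finset.mul_sum] at h1
    simp at h1
    have h2 := mul_le_mul_of_nonneg_left hinv hK₃0
    have h3 : 0 ≤ lam * (t + 1) * d t := mul_nonneg (by positivity) (hd t)
    have h4 := mul_le_mul_of_nonneg_left hl (mul_nonneg hlam.le (hd 0))
    have h5 := mul_nonneg (div_nonneg hK₃0 hlam.le) (by linarith : 0 ≤ 1 + Real.log t)
    have h6 := mul_nonneg (hd 0) (by linarith : 0 ≤ 1 + Real.log t)
    linarith

end Rates

/-! ### Mirror descent with the Bethe entropy -/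

section MirrorDescent

open Filter Topology

variable {V : Type*} [Fintype V] [DecidableEq V]
  {X : V → Type*} [∀ i, Fintype (X i)] [∀ i, DecidableEq (X i)] {𝒞 : Finset (Finset V)}

theorem exists_isMinOn_augObjective [∀ i, Nonempty (X i)] (θ : MargVec X 𝒞)
    {L : MargVec X 𝒞 → ℝ} {K : NNReal} (hL : LipschitzOnWith K L (marginalPolytope X 𝒞)) :
    ∃ p ∈ marginalPolytope X 𝒞, IsMinOn (augObjective 𝒞 θ L) (marginalPolytope X 𝒞) p ∧
      ∀ k, 0 < p k := by
  have hcont : ContinuousOn (augObjective 𝒞 θ L) (marginalPolytope X 𝒞) := by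
    unfold augObjective
    refine ContinuousOn.add (Continuous.continuousOn ?_) hL.continuousOn
    have := continuous_betheEntropy (X := X) (𝒞 := 𝒞)
    fun_prop
  obtain ⟨p, hp, hmin⟩ := isCompact_marginalPolytope.exists_isMinOn nonempty_marginalPolytope hcont
  refine ⟨p, hp, hmin, pos_of_isMinOn (φ := fun μ => -⟪θ, μ⟫ + L μ)
    ((lipschitzWith_neg_inner θ).lipschitzOnWith.add hL) hp ?_⟩
  have : (fun μ => -betheEntropy 𝒞 μ + (-⟪θ, μ⟫ + L μ)) = augObjective 𝒞 θ L := by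
    ext μ
    rw [augObjective]
    ring
  rwa [this]

/-- One step of mirror descent. -/
theorem mirror_step {L : MargVec X 𝒞 → ℝ} {K : NNReal} {lam : ℝ} (hlam : 0 < lam)
    (hH : StrongConvexOn (marginalPolytope X 𝒞) lam (fun μ => -betheEntropy 𝒞 μ))
    (hLconv : ConvexOn ℝ (marginalPolytope X 𝒞) L)
    (hLlip : LipschitzOnWith K L (marginalPolytope X 𝒞))
    {θ l u v w : MargVec X 𝒞} (hu : u ∈ marginalPolytope X 𝒞) (hv : v ∈ marginalPolytope X 𝒞)
    (hw : w ∈ marginalPolytope X 𝒞) (hwpos : ∀ k, 0 < w k) (hl : HasGradientAt L l w)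
    {η : ℝ} (hη : 0 < η)
    (hfoc : 0 ≤ ⟪-entropyGrad v - (1 / (1 + η)) • (η • θ - (entropyGrad w + η • l)), u - v⟫) :
    η * (augObjective 𝒞 θ L v - augObjective 𝒞 θ L u) + (1 + η) * bregman u v ≤
      bregman u w + 2 * K ^ 2 * η ^ 2 / lam := by
  have hfoc' : 0 ≤ -(1 + η) * ⟪entropyGrad v, u - v⟫ - η * ⟪θ, u - v⟫ +
      ⟪entropyGrad w, u - v⟫ + η * ⟪l, u - v⟫ := by
    have h1 : (0 : ℝ) < 1 + η := by linarith
    have := mul_nonneg h1.le hfoc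
    simp only [inner_sub_left, inner_neg_left, inner_smul_left, inner_add_left, conj_trivial,
      mul_sub] at this
    rw [← mul_assoc, mul_one_div_cancel h1.ne', ← mul_assoc (1 + η) (1 / (1 + η)),
      mul_one_div_cancel h1.ne'] at this
    linarith
  have h1 := bregman_lower_bound hH hv hw hwpos
  have h2 := hLconv.add_inner_le hl hw hu
  have h3 := (abs_le.1 (hLlip.abs_inner_gradient_le convex_marginalPolytope hl hw hv)).1
  have h4 : L v - L w ≤ K * ‖v - w‖ := by
    have := hLlip.dist_le_mul _ hv _ hw
    rw [Real.dist_eq, dist_eq_norm] at this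
    exact (le_abs_self _).trans this
  have e1 : ⟪entropyGrad w, u - v⟫ = ⟪entropyGrad w, u - w⟫ - ⟪entropyGrad w, v - w⟫ := by
    rw [← inner_sub_right]; congr 1; abel
  have e2 : ⟪l, u - v⟫ = ⟪l, u - w⟫ - ⟪l, v - w⟫ := by
    rw [← inner_sub_right]; congr 1; abel
  have e3 : ⟪θ, u - v⟫ = ⟪θ, u⟫ - ⟪θ, v⟫ := inner_sub_right _ _ _
  -- Completing the square. One `K` bounds the change of `L`, the other its linearization along `v -
  -- w`.
  have h5 : 2 * K * η * ‖v - w‖ - lam / 2 * ‖v - w‖ ^ 2 ≤ 2 * K ^ 2 * η ^ 2 / lam := by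
    rw [le_div_iff₀ hlam]
    nlinarith [sq_nonneg (lam * ‖v - w‖ - 2 * K * η)]
  have h6 : η * (L v - L u + ⟪l, u - v⟫) ≤ η * (2 * K * ‖v - w‖) :=
    mul_le_mul_of_nonneg_left (by rw [e2]; linarith) hη.le
  rw [e1, e3] at hfoc'
  simp only [augObjective, bregman] at h1 ⊢
  linarith

/-- The optimality gap of the augmented objective beyond the Bregman divergence to the minimizer. -/
def excessGap (θ : MargVec X 𝒞) (L : MargVec X 𝒞 → ℝ) (p v : MargVec X 𝒞) : ℝ :=
  L v - L p + ⟪-entropyGrad p - θ, v - p⟫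

/-- The split separates the part of the gap that pays for telescoping from the convex remainder that
is averaged. -/
theorem augObjective_sub_eq (θ : MargVec X 𝒞) (L : MargVec X 𝒞 → ℝ) (p v : MargVec X 𝒞) :
    augObjective 𝒞 θ L v - augObjective 𝒞 θ L p = bregman v p + excessGap θ L p v := by
  simp only [augObjective, bregman, excessGap, inner_sub_left, inner_neg_left, inner_sub_right]
  ring

/-- Convexity of `L` bounds its increment below by `⟨∇L(p), v - p⟩`, and then optimality of `p`
applies. -/
theorem excessGap_nonneg [∀ i, Nonempty (X i)] {θ : MargVec X 𝒞} {L : MargVec X 𝒞 → ℝ}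
    (hLconv : ConvexOn ℝ (marginalPolytope X 𝒞) L) {p v : MargVec X 𝒞}
    (hp : p ∈ marginalPolytope X 𝒞)
    (hmin : IsMinOn (augObjective 𝒞 θ L) (marginalPolytope X 𝒞) p) (hpos : ∀ k, 0 < p k)
    (hL : DifferentiableAt ℝ L p) (hv : v ∈ marginalPolytope X 𝒞) : 0 ≤ excessGap θ L p v := by
  have hg : HasGradientAt (augObjective 𝒞 θ L) (-entropyGrad p - θ + ∇ L p) p := by
    rw [hasGradientAt_iff_hasFDerivAt, map_add, map_sub]
    exact ((HasGradientAt.neg_betheEntropy hpos).hasFDerivAt.sub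
      (hasGradientAt_inner θ _).hasFDerivAt).add hL.hasGradientAt.hasFDerivAt
  have h1 := hmin.inner_gradient_nonneg convex_marginalPolytope hg hp hv
  have h2 := hLconv.add_inner_le hL.hasGradientAt hp hv
  rw [inner_add_left] at h1
  rw [excessGap]
  linarith

theorem convexOn_excessGap {θ : MargVec X 𝒞} {L : MargVec X 𝒞 → ℝ}
    (hLconv : ConvexOn ℝ (marginalPolytope X 𝒞) L) (p : MargVec X 𝒞) :
    ConvexOn ℝ (marginalPolytope X 𝒞) (excessGap θ L p) := by
  refine ⟨hLconv.1, fun x hx y hy a b ha hb hab => ?_⟩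
  have h := hLconv.2 hx hy ha hb hab
  have e : a • x + b • y - p = a • (x - p) + b • (y - p) := by
    rw [smul_sub, smul_sub, sub_add_sub_comm, ← add_smul, hab, one_smul]
  simp only [excessGap, e, inner_add_right, inner_smul_right, smul_eq_mul] at h ⊢
  have : L p = a * L p + b * L p := by rw [← add_mul, hab, one_mul]
  linarith

/-- Near `p`, strong convexity converts the cubic error in the norm into the power 3/2 of the
divergence. Away from `p`, the divergence is bounded below, so it is itself dominated by its power
3/2, and the subtracted term is nonnegative. -/
theorem bregman_sub_le_rpow {p : MargVec X 𝒞} (hp : p ∈ marginalPolytope X 𝒞)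
    (hpos : ∀ k, 0 < p k) {lam : ℝ} (hlam : 0 < lam)
    (hH : StrongConvexOn (marginalPolytope X 𝒞) lam (fun μ => -betheEntropy 𝒞 μ)) :
    ∃ C, 0 ≤ C ∧ ∀ w ∈ marginalPolytope X 𝒞, (∀ k, 0 < w k) →
      bregman p w - bregman w p ≤ C * bregman p w ^ (3 / 2 : ℝ) := by
  obtain ⟨ρ, C, hρ, hC, hcube⟩ := exists_bregman_sub_le_cube hpos
  have hl2 : 0 < lam / 2 := half_pos hlam
  set κ := (lam / 2) ^ (3 / 2 : ℝ) with hκ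
  have hκ0 : 0 < κ := Real.rpow_pos_of_pos hl2 _
  set ν := (lam / 2 * ρ ^ 2) ^ (1 / 2 : ℝ) with hν
  have hν0 : 0 < ν := by positivity
  refine ⟨C / κ + 1 / ν, by positivity, fun w hw hwpos => ?_⟩
  have hlow := bregman_lower_bound hH hp hw hwpos
  rw [norm_sub_rev] at hlow
  have hlow' := bregman_lower_bound hH hw hp hpos
  have hb0 : 0 ≤ bregman p w := le_trans (by positivity) hlow
  have hb0' : 0 ≤ bregman w p := le_trans (by positivity) hlow'
  have hr0 : 0 ≤ bregman p w ^ (3 / 2 : ℝ) := Real.rpow_nonneg hb0 _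
  rw [add_mul]
  rcases le_or_gt ‖w - p‖ ρ with h | h
  · have h1 := hcube w hwpos h
    have h2 : κ * ‖w - p‖ ^ 3 ≤ bregman p w ^ (3 / 2 : ℝ) := by
      have := Real.rpow_le_rpow (by positivity) hlow (by norm_num : (0 : ℝ) ≤ 3 / 2)
      rw [Real.mul_rpow hl2.le (by positivity), ← Real.rpow_natCast,
        ← Real.rpow_mul (norm_nonneg _)] at this
      rw [← Real.rpow_natCast]
      convert this using 3
      norm_num
    have h3 : C * ‖w - p‖ ^ 3 ≤ C / κ * bregman p w ^ (3 / 2 : ℝ) := by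
      rw [div_mul_eq_mul_div, le_div_iff₀ hκ0]
      have := mul_le_mul_of_nonneg_left h2 hC
      linarith
    have h4 : 0 ≤ 1 / ν * bregman p w ^ (3 / 2 : ℝ) := by positivity
    linarith
  · have h1 : lam / 2 * ρ ^ 2 ≤ bregman p w := by
      refine le_trans ?_ hlow
      gcongr
    have h2 : ν ≤ bregman p w ^ (1 / 2 : ℝ) :=
      Real.rpow_le_rpow (by positivity) h1 (by norm_num)
    have hbpos : 0 < bregman p w := lt_of_lt_of_le (by positivity) h1
    have h3 : bregman p w ^ (3 / 2 : ℝ) = bregman p w * bregman p w ^ (1 / 2 : ℝ) := by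
      rw [← Real.rpow_one_add' hb0 (by norm_num)]; norm_num
    have h4 : bregman p w ≤ 1 / ν * bregman p w ^ (3 / 2 : ℝ) := by
      rw [h3, div_mul_eq_mul_div, one_mul, le_div_iff₀ hν0]
      exact mul_le_mul_of_nonneg_left h2 hb0
    have h5 : 0 ≤ C / κ * bregman p w ^ (3 / 2 : ℝ) := by positivity
    linarith

theorem primalAverage_eq_sum (μ : ℕ → MargVec X 𝒞) (t : ℕ) :
    primalAverage μ t = ∑ s ∈ Finset.Icc 1 t, (1 / (t : ℝ)) • μ s := by
  rw [primalAverage, Finset.smul_sum]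

theorem sum_Icc_const_one_div {t : ℕ} (ht : 1 ≤ t) :
    ∑ _s ∈ Finset.Icc 1 t, 1 / (t : ℝ) = 1 := by
  have : (t : ℝ) ≠ 0 := by positivity
  simp [this]

theorem primalAverage_mem {μ : ℕ → MargVec X 𝒞} (hμ : ∀ t, μ t ∈ marginalPolytope X 𝒞)
    {t : ℕ} (ht : 1 ≤ t) : primalAverage μ t ∈ marginalPolytope X 𝒞 := by
  rw [primalAverage_eq_sum]
  exact convex_marginalPolytope.sum_mem (fun _ _ => by positivity) (sum_Icc_const_one_div ht)
    fun s _ => hμ s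

theorem norm_primalAverage_sub_le {μ : ℕ → MargVec X 𝒞} {p : MargVec X 𝒞} {t : ℕ} (ht : 1 ≤ t) :
    ‖primalAverage μ t - p‖ ≤ 1 / (t : ℝ) * ∑ s ∈ Finset.Icc 1 t, ‖μ s - p‖ := by
  have h : primalAverage μ t - p = ∑ s ∈ Finset.Icc 1 t, (1 / (t : ℝ)) • (μ s - p) := by
    simp only [smul_sub, Finset.sum_sub_distrib, ← primalAverage_eq_sum, ← Finset.sum_smul,
      sum_Icc_const_one_div ht, one_smul]
  rw [h, Finset.mul_sum]
  refine (norm_sum_le _ _).trans (Finset.sum_le_sum fun s _ => ?_)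
  rw [norm_smul, Real.norm_of_nonneg (by positivity)]

end MirrorDescent

/-! ### From the one-step recursion to the averages. -/

section Main

open Filter Topology

variable {V : Type*} [Fintype V] [DecidableEq V]
  {X : V → Type*} [∀ i, Fintype (X i)] [∀ i, DecidableEq (X i)] {𝒞 : Finset (Finset V)}

theorem subsingleton_marginalPolytope [∀ i, Nonempty (X i)] (h : ∀ i, Subsingleton (X i)) :
    (marginalPolytope X 𝒞).Subsingleton := by
  have key : ∀ u ∈ marginalPolytope X 𝒞, u = suffStat 𝒞 fun _ => Classical.arbitrary _ := by
    rintro _ ⟨P, hP, rfl⟩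
    have hc : ∀ y ∈ Finset.univ, P y • suffStat 𝒞 y =
        P y • suffStat 𝒞 fun _ => Classical.arbitrary _ := fun y _ => by
      rw [Subsingleton.elim y fun _ => Classical.arbitrary _]
    rw [meanStat, Finset.sum_congr rfl hc, ← Finset.sum_smul, hP.2, one_smul]
  exact fun u hu w hw => (key u hu).trans (key w hw).symm

/-- A sequence in the polytope whose divergence to the minimizer decays like `log t / t`, and whose
excess gaps sum up to `O(log t)`, has averages with optimality gap `O(log t / t)`, which converge to
the minimizer. -/
theorem rate_of_primalAverage {θ : MargVec X 𝒞} {L : MargVec X 𝒞 → ℝ}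
    (hLconv : ConvexOn ℝ (marginalPolytope X 𝒞) L) {lam : ℝ} (hlam : 0 < lam)
    (hH : StrongConvexOn (marginalPolytope X 𝒞) lam (fun μ => -betheEntropy 𝒞 μ))
    {p : MargVec X 𝒞} (hp : p ∈ marginalPolytope X 𝒞) (hpos : ∀ k, 0 < p k)
    {μ : ℕ → MargVec X 𝒞} (hμ : ∀ t, μ t ∈ marginalPolytope X 𝒞) (hμpos : ∀ t k, 0 < μ t k)
    {B : ℝ} (hB : 0 ≤ B)
    (hd : ∀ t : ℕ, 1 ≤ t → bregman p (μ t) ≤ B * (1 + Real.log t) / t)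
    (hG : ∀ t : ℕ, 1 ≤ t →
      ∑ s ∈ Finset.Icc 1 t, excessGap θ L p (μ s) ≤ B * (1 + Real.log t)) :
    Tendsto (fun t => primalAverage μ t) atTop (𝓝 p) ∧
      ∃ C, ∀ t : ℕ, 2 ≤ t → augObjective 𝒞 θ L (primalAverage μ t) - augObjective 𝒞 θ L p ≤
        C * (Real.log t / t) := by
  have hlog : ∀ t : ℕ, 1 ≤ t → 0 ≤ Real.log (t : ℝ) := fun t ht =>
    Real.log_nonneg (by exact_mod_cast ht)
  set K := 2 * B / lam with hK
  have hK0 : 0 ≤ K := by positivity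
  have hnorm : ∀ t : ℕ, 1 ≤ t →
      ‖primalAverage μ t - p‖ ^ 2 ≤ 4 * K * ((1 + Real.log t) / t) := by
    intro t ht
    have ht0 : (0 : ℝ) < t := by exact_mod_cast ht
    have hl := hlog t ht
    -- Replacing `log s` by `log t` leaves a multiple of `s^(-1/2)`. Averaging then costs only a
    -- factor 2 over the bound for the last iterate.
    have h1 : ∀ s ∈ Finset.Icc 1 t, ‖μ s - p‖ ≤ √(K * (1 + Real.log t)) * (√(s : ℝ))⁻¹ := by
      intro s hs
      obtain ⟨hs1, hst⟩ := Finset.mem_Icc.1 hs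
      have hs0 : (0 : ℝ) < s := by exact_mod_cast hs1
      rw [← Real.sqrt_inv, ← Real.sqrt_mul (by positivity)]
      refine Real.le_sqrt_of_sq_le ?_
      have h2 := (bregman_lower_bound hH hp (hμ s) (hμpos s)).trans (hd s hs1)
      rw [norm_sub_rev] at h2
      have h3 : Real.log s ≤ Real.log t := Real.log_le_log hs0 (by exact_mod_cast hst)
      have h4 : B * (1 + Real.log s) / s ≤ B * (1 + Real.log t) / s := by gcongr
      have h5 : K * (1 + Real.log t) * (s : ℝ)⁻¹ = 2 / lam * (B * (1 + Real.log t) / s) := by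
        rw [hK]; field_simp
      rw [h5]
      calc ‖μ s - p‖ ^ 2 = 2 / lam * (lam / 2 * ‖μ s - p‖ ^ 2) := by field_simp
        _ ≤ _ := by
          have := h2.trans h4
          gcongr
    have h2 : ‖primalAverage μ t - p‖ ≤
        1 / (t : ℝ) * (√(K * (1 + Real.log t)) * (2 * √(t : ℝ))) := by
      refine (norm_primalAverage_sub_le ht).trans ?_
      refine mul_le_mul_of_nonneg_left ((Finset.sum_le_sum h1).trans ?_) (by positivity)
      rw [← Finset.mul_sum]
      exact mul_le_mul_of_nonneg_left (sum_Icc_inv_sqrt_le t) (Real.sqrt_nonneg _)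
    refine (pow_le_pow_left₀ (norm_nonneg _) h2 2).trans (le_of_eq ?_)
    rw [mul_pow, mul_pow, mul_pow, Real.sq_sqrt (by positivity), Real.sq_sqrt ht0.le]
    field_simp
    ring
  have hlogt : Tendsto (fun t : ℕ => (1 + Real.log t) / (t : ℝ)) atTop (𝓝 0) := by
    have h1 : Tendsto (fun t : ℕ => Real.log (t : ℝ) / t) atTop (𝓝 0) :=
      (Real.isLittleO_log_id_atTop.tendsto_div_nhds_zero).comp tendsto_natCast_atTop_atTop
    have h2 := tendsto_one_div_atTop_nhds_zero_nat (𝕜 := ℝ)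
    have h3 := h2.add h1
    rw [add_zero] at h3
    exact h3.congr fun t => by rw [add_div]
  constructor
  · rw [tendsto_iff_norm_sub_tendsto_zero]
    have h1 : Tendsto (fun t : ℕ => ‖primalAverage μ t - p‖ ^ 2) atTop (𝓝 0) := by
      refine squeeze_zero' (Eventually.of_forall fun t => sq_nonneg _)
        ((eventually_ge_atTop 1).mono hnorm) ?_
      simpa using hlogt.const_mul (4 * K)
    have h2 := h1.sqrt
    simpa using h2
  · obtain ⟨C, hC, hsq⟩ := exists_bregman_le_mul_sq hpos
    -- The last factor absorbs the 1 in `1 + log t`, as `log t ≥ log 2` for `t ≥ 2`.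
    refine ⟨(C * (4 * K) + B) * (1 / Real.log 2 + 1), fun t ht => ?_⟩
    have ht1 : 1 ≤ t := by omega
    have ht0 : (0 : ℝ) < t := by exact_mod_cast ht1
    have hmem := primalAverage_mem hμ ht1
    have h1 := hsq _ (nonneg_of_mem hmem)
    have h2 := mul_le_mul_of_nonneg_left (hnorm t ht1) hC
    have h3 : excessGap θ L p (primalAverage μ t) ≤ B * ((1 + Real.log t) / t) := by
      rw [primalAverage_eq_sum]
      refine ((convexOn_excessGap hLconv p).map_sum_le (fun _ _ => by positivity)
        (sum_Icc_const_one_div ht1) fun s _ => hμ s).trans ?_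
      simp only [smul_eq_mul]
      rw [← Finset.mul_sum]
      have := mul_le_mul_of_nonneg_left (hG t ht1) (by positivity : 0 ≤ 1 / (t : ℝ))
      refine this.trans (le_of_eq ?_)
      field_simp
    have hl2 : 0 < Real.log 2 := Real.log_pos (by norm_num)
    have h4 : 1 ≤ 1 / Real.log 2 * Real.log t := by
      rw [one_div, ← div_eq_inv_mul, one_le_div hl2]
      exact Real.log_le_log two_pos (by exact_mod_cast ht)
    rw [augObjective_sub_eq]
    calc bregman (primalAverage μ t) p + excessGap θ L p (primalAverage μ t)
        ≤ (C * (4 * K) + B) * ((1 + Real.log t) / t) := by linarith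
      _ ≤ (C * (4 * K) + B) * ((1 / Real.log 2 * Real.log t + Real.log t) / t) := by gcongr
      _ = _ := by ring

/-- The recursion for the divergence of the iterates of Bethe-MD to the minimizer. -/
theorem iterates_recursion [∀ i, Nonempty (X i)] {O : MargVec X 𝒞 → MargVec X 𝒞}
    (hO : IsBetheOracle 𝒞 O ∨ IsExactTreeOracle 𝒞 O) {θ : MargVec X 𝒞} {L : MargVec X 𝒞 → ℝ}
    (hLconv : ConvexOn ℝ (marginalPolytope X 𝒞) L)
    (hLdiff : ∀ μ ∈ marginalPolytope X 𝒞, (∀ k, 0 < μ k) → DifferentiableAt ℝ L μ)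
    {K : NNReal} (hLlip : LipschitzOnWith K L (marginalPolytope X 𝒞)) {lam : ℝ} (hlam : 0 < lam)
    (hH : StrongConvexOn (marginalPolytope X 𝒞) lam (fun μ => -betheEntropy 𝒞 μ))
    {η : ℕ → ℝ} (hη : ∀ t : ℕ, 1 ≤ t → η t = 1 / (lam * (t : ℝ))) {p : MargVec X 𝒞}
    (hp : p ∈ marginalPolytope X 𝒞) {t : ℕ}
    (hmem : iterates 𝒞 O θ L η t ∈ marginalPolytope X 𝒞) (hpos : ∀ k, 0 < iterates 𝒞 O θ L η t k) :
    excessGap θ L p (iterates 𝒞 O θ L η (t + 1)) + bregman (iterates 𝒞 O θ L η (t + 1)) p +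
      (lam * (t + 1) + 1) * bregman p (iterates 𝒞 O θ L η (t + 1)) ≤
      lam * (t + 1) * bregman p (iterates 𝒞 O θ L η t) + 2 * K ^ 2 / lam ^ 2 / (t + 1) := by
  set w := iterates 𝒞 O θ L η t with hw
  have hη1 : η (t + 1) = 1 / (lam * (t + 1)) := by
    rw [hη (t + 1) (by omega)]; push_cast; rfl
  have hη0 : 0 < η (t + 1) := by rw [hη1]; positivity
  have hit : iterates 𝒞 O θ L η (t + 1) = O ((1 / (1 + η (t + 1))) • (η (t + 1) • θ -
      (entropyGrad w + η (t + 1) • ∇ L w))) := by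
    rw [← gradient_betheEntropy hpos]
    rfl
  obtain ⟨hvmem, -, hfoc⟩ := oracle_spec hO ((1 / (1 + η (t + 1))) • (η (t + 1) • θ -
      (entropyGrad w + η (t + 1) • ∇ L w)))
  rw [← hit] at hvmem hfoc
  have hstep := mirror_step hlam hH hLconv hLlip (θ := θ) hp hvmem hmem hpos
    (hLdiff w hmem hpos).hasGradientAt hη0 (hfoc p hp)
  rw [augObjective_sub_eq] at hstep
  have hs : 0 < lam * (t + 1 : ℝ) := by positivity
  -- Multiplication by `lam * (t + 1)`, which is the inverse of the learning rate.
  have h := mul_le_mul_of_nonneg_left hstep hs.le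
  rw [hη1] at h
  refine le_trans (le_of_eq ?_) (h.trans (le_of_eq ?_))
  · field_simp
    ring
  · field_simp

end Main

end BetheMD

end

theorem mainTheorem4 {V : Type*} [Fintype V] [DecidableEq V]
    {X : V → Type*} [∀ i, Fintype (X i)] [∀ i, DecidableEq (X i)] [∀ i, Nonempty (X i)]
    (𝒞 : Finset (Finset V))
    (O : BetheMD.MargVec X 𝒞 → BetheMD.MargVec X 𝒞)
    (hO : BetheMD.IsBetheOracle 𝒞 O ∨ BetheMD.IsExactTreeOracle 𝒞 O)
    (θ : BetheMD.MargVec X 𝒞)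
    (L : BetheMD.MargVec X 𝒞 → ℝ)
    (hLconv : ConvexOn ℝ (BetheMD.marginalPolytope X 𝒞) L)
    (hLdiff : ∀ μ ∈ BetheMD.marginalPolytope X 𝒞, (∀ k, 0 < μ k) → DifferentiableAt ℝ L μ)
    (hLlip : ∃ K : NNReal, LipschitzOnWith K L (BetheMD.marginalPolytope X 𝒞))
    (lam : ℝ) (hlam : 0 < lam)
    (hH : StrongConvexOn (intrinsicInterior ℝ (BetheMD.marginalPolytope X 𝒞)) lam
      (fun μ => -BetheMD.betheEntropy 𝒞 μ))
    (η : ℕ → ℝ) (hη : ∀ t : ℕ, 1 ≤ t → η t = 1 / (lam * (t : ℝ))) :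
    ∃ μstar ∈ BetheMD.marginalPolytope X 𝒞,
      IsMinOn (BetheMD.augObjective 𝒞 θ L) (BetheMD.marginalPolytope X 𝒞) μstar ∧
      (∀ t : ℕ, 1 ≤ t → BetheMD.primalAverage (BetheMD.iterates 𝒞 O θ L η) t ∈
        BetheMD.marginalPolytope X 𝒞) ∧
      Filter.Tendsto (fun t : ℕ => BetheMD.primalAverage (BetheMD.iterates 𝒞 O θ L η) t)
        Filter.atTop (nhds μstar) ∧
      ∃ C : ℝ, ∀ t : ℕ, 2 ≤ t →
        BetheMD.augObjective 𝒞 θ L (BetheMD.primalAverage (BetheMD.iterates 𝒞 O θ L η) t) -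
          BetheMD.augObjective 𝒞 θ L μstar ≤ C * (Real.log (t : ℝ) / (t : ℝ)) := by
  have hH' := hH.of_intrinsicInterior BetheMD.convex_marginalPolytope
    BetheMD.continuous_betheEntropy.neg
  obtain ⟨K, hK⟩ := hLlip
  obtain ⟨p, hp, hmin, hpos⟩ := BetheMD.exists_isMinOn_augObjective θ hK
  have hit : ∀ t, BetheMD.iterates 𝒞 O θ L η t ∈ BetheMD.marginalPolytope X 𝒞 ∧
      ∀ k, 0 < BetheMD.iterates 𝒞 O θ L η t k := by
    rintro (_ | t)
    · exact ⟨(BetheMD.oracle_spec hO _).1, (BetheMD.oracle_spec hO _).2.1⟩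
    · exact ⟨(BetheMD.oracle_spec hO _).1, (BetheMD.oracle_spec hO _).2.1⟩
  have havg : ∀ t : ℕ, 1 ≤ t → BetheMD.primalAverage (BetheMD.iterates 𝒞 O θ L η) t ∈
      BetheMD.marginalPolytope X 𝒞 := fun t ht =>
    BetheMD.primalAverage_mem (fun t => (hit t).1) ht
  refine ⟨p, hp, hmin, havg, ?_⟩
  -- The bound `lam ≤ 2` needs a node with two states. Otherwise `lam` can be arbitrarily large, but
  -- the polytope is a single point.
  by_cases hX : ∃ i, Nontrivial (X i)
  · obtain ⟨i, hi⟩ := hX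
    obtain ⟨C, hC, hcmp⟩ := BetheMD.bregman_sub_le_rpow hp hpos hlam hH'
    have hnn : ∀ {u w : BetheMD.MargVec X 𝒞}, u ∈ BetheMD.marginalPolytope X 𝒞 →
        w ∈ BetheMD.marginalPolytope X 𝒞 → (∀ k, 0 < w k) → 0 ≤ BetheMD.bregman u w :=
      fun hu hw hw0 => le_trans (by positivity) (BetheMD.bregman_lower_bound hH' hu hw hw0)
    obtain ⟨B, hB, hrate⟩ := BetheMD.exists_rates hlam (BetheMD.strongConvexity_le_two hH' hi)
      (by positivity : (0 : ℝ) ≤ 2 * K ^ 2 / lam ^ 2) hC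
      (d := fun t => BetheMD.bregman p (BetheMD.iterates 𝒞 O θ L η t))
      (d' := fun t => BetheMD.bregman (BetheMD.iterates 𝒞 O θ L η t) p)
      (G := fun t => BetheMD.excessGap θ L p (BetheMD.iterates 𝒞 O θ L η t))
      (fun t => hnn hp (hit t).1 (hit t).2) (fun t => hnn (hit t).1 hp hpos)
      (fun t => BetheMD.excessGap_nonneg hLconv hp hmin hpos (hLdiff p hp hpos) (hit t).1)
      (fun t => hcmp _ (hit t).1 (hit t).2)
      (fun t => BetheMD.iterates_recursion hO hLconv hLdiff hK hlam hH' hη hp (hit t).1 (hit t).2)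
    exact BetheMD.rate_of_primalAverage hLconv hlam hH' hp hpos (fun t => (hit t).1)
      (fun t => (hit t).2) hB (fun t ht => (hrate t ht).1) (fun t ht => (hrate t ht).2)
  · simp only [not_exists, not_nontrivial_iff_subsingleton] at hX
    have heq : ∀ t : ℕ, 1 ≤ t → BetheMD.primalAverage (BetheMD.iterates 𝒞 O θ L η) t = p :=
      fun t ht => BetheMD.subsingleton_marginalPolytope hX (havg t ht) hp
    refine ⟨tendsto_const_nhds.congr' ?_, 0, fun t ht => ?_⟩
    · filter_upwards [Filter.eventually_ge_atTop 1] with t ht using (heq t ht).symm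
    · rw [heq t (by omega), sub_self, zero_mul]
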